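/- Let $F$ be a field of characteristic $0$; algebras over $F$ are not assumed associative or unital. A superalgebra is a $\mathbb Z_2$-graded algebra $A=A_0\oplus A_1$, $A_iA_j\subseteq A_{i+j}$. Let $G=G_0\oplus G_1$ be the Grassmann algebra over $F$ on a countable set of anticommuting generators, where $G_0$ and $G_1$ are spanned by the products of an even, respectively odd, number of generators. The Grassmann envelope of $A$ is the subalgebra $G(A)=G_0\otimes A_0+G_1\otimes A_1$ of $G\otimes A$. The superalgebra $A$ satisfies the superidentity corresponding to a multilinear nonassociative polynomial $f$ if $G(A)$ satisfies the identity $f=0$. For a variety $\mathcal V$ of algebras over $F$, a $\mathcal V$-superalgebra is a superalgebra whose Grassmann envelope lies in $\mathcal V$; let $\tilde{\mathcal V}$ be the class of all $\mathcal V$-superalgebras. For integers $r,s\ge 0$ let $\mathcal V_{r,s}$ be the supervariety generated by the free $\mathcal V$-superalgebra on $r$ even and $s$ odd generators, that is, the class of all superalgebras satisfying every superidentity satisfied by that free superalgebra (so $\mathcal V_{0,0}$ consists of zero superalgebras only). A pair $(r,s)$ is a basic superrank of $\mathcal V$ if $\mathcal V_{r,s}=\tilde{\mathcal V}$ and $\mathcal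 V_{r',s'}\ne\tilde{\mathcal V}$ for every pair $(r',s')\neq(r,s)$ with $r'\le r$ and $s'\le s$. The basic spectrum of $\mathcal V$ is the set of all its basic superranks. Let $\mathrm{Malc}^{(2)}$ be the variety of metabelian Malcev algebras over $F$, defined by the identities $$xy+yx=0,\qquad J(x,y,z)\,x=J(x,y,xz),\qquad (xy)(zt)=0,$$ where $J(x,y,z)=(xy)z+(yz)x+(zx)y$. Then the basic spectrum of $\mathrm{Malc}^{(2)}$ is exactly $\{(1,1)\}$. -/

import Mathlib

universe u v

open scoped TensorProduct

noncomputable section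

namespace Superrank

/-! ### Nonassociative polynomials, identities and varieties -/

/-- Nonassociative polynomials without constant term over `F` in the variables `x 0, x 1, …`. -/
abbrev NAPoly (F : Type u) [Field F] : Type u := FreeNonUnitalNonAssocAlgebra F ℕ

/-- The variable `x i`. -/
def var (F : Type u) [Field F] (i : ℕ) : NAPoly F := FreeNonUnitalNonAssocAlgebra.of F i

/-- The number of occurrences of the variable `i` in a nonassociative word. -/
def occ (i : ℕ) : FreeMagma ℕ → ℕ
  | .of j => if j = i then 1 else 0
  | .mul a b => occ i a + occ i b

/-- `f` is multilinear of some degree `n`: each of the variables `x 0, …, x (n - 1)` occurs exactly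
once in every monomial of `f`, and no other variable occurs. -/
def IsMultilinear {F : Type u} [Field F] (f : NAPoly F) : Prop :=
  ∃ n : ℕ, ∀ w ∈ f.coeff.support, ∀ i : ℕ, occ i w = if i < n then 1 else 0

/-- The (not necessarily associative or unital) algebra `A` satisfies the identity `f = 0`. -/
def SatisfiesIdentity {F : Type u} [Field F] (f : NAPoly F) (A : Type v) [NonUnitalNonAssocRing A]
    [Module F A] [IsScalarTower F A A] [SMulCommClass F A A] : Prop :=
  ∀ a : ℕ → A, FreeNonUnitalNonAssocAlgebra.lift F a f = 0

/-- `A` lies in the variety of algebras defined by the set `S` of identities. -/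
def InVariety {F : Type u} [Field F] (S : Set (NAPoly F)) (A : Type v) [NonUnitalNonAssocRing A]
    [Module F A] [IsScalarTower F A A] [SMulCommClass F A A] : Prop :=
  ∀ f ∈ S, SatisfiesIdentity f A

/-- The Jacobian `J(a,b,c) = (ab)c + (bc)a + (ca)b`. -/
def jacobian {A : Type v} [NonUnitalNonAssocRing A] (a b c : A) : A :=
  (a * b) * c + (b * c) * a + (c * a) * b

/-- The identities `xy + yx = 0` and `J(x,y,z)x = J(x,y,xz)` defining Malcev algebras. -/
def malcev (F : Type u) [Field F] : Set (NAPoly F) :=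
  {var F 0 * var F 1 + var F 1 * var F 0,
    jacobian (var F 0) (var F 1) (var F 2) * var F 0 - jacobian (var F 0) (var F 1) (var F 0 * var F 2)}

/-- The identity `(xy)(zt) = 0` defining metabelian algebras. -/
def metabelian (F : Type u) [Field F] : Set (NAPoly F) :=
  {(var F 0 * var F 1) * (var F 2 * var F 3)}

/-! ### Superalgebras and their Grassmann envelopes -/

/-- A superalgebra over `F`: a (not necessarily associative or unital) algebra with a
`ℤ/2`-grading; `part 0` is the even part and `part 1` is the odd part. -/
structure Superalgebra (F : Type u) [Field F] where
  carrier : Type u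
  [ring : NonUnitalNonAssocRing carrier]
  [module : Module F carrier]
  [tower : IsScalarTower F carrier carrier]
  [comm : SMulCommClass F carrier carrier]
  part : ZMod 2 → Submodule F carrier
  isCompl : IsCompl (part 0) (part 1)
  mul_mem : ∀ (i j : ZMod 2) (a b : carrier), a ∈ part i → b ∈ part j → a * b ∈ part (i + j)

attribute [instance] Superalgebra.ring Superalgebra.module Superalgebra.tower Superalgebra.comm

/-- The Grassmann algebra on the countable set of generators `ι (single k 1)`, `k : ℕ`. -/
abbrev Grassmann (F : Type u) [Field F] : Type u := ExteriorAlgebra F (ℕ →₀ F)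

/-- The part `G₀` or `G₁` of the Grassmann algebra: the span of the products of an even or,
respectively, odd number of elements of the generating space. -/
def grassmannPart (F : Type u) [Field F] (i : ZMod 2) : Submodule F (Grassmann F) :=
  CliffordAlgebra.evenOdd (0 : QuadraticForm F (ℕ →₀ F)) i

/-- `G₀ ⊗ A₀ + G₁ ⊗ A₁` as a subspace of `G ⊗ A`. -/
def envelopeSubmodule {F : Type u} [Field F] (A : Superalgebra F) :
    Submodule F (Grassmann F ⊗[F] A.carrier) :=
  Submodule.span F {t | ∃ i : ZMod 2, ∃ g ∈ grassmannPart F i, ∃ a ∈ A.part i, t = g ⊗ₜ[F] a}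

theorem envelopeSubmodule_mul_mem {F : Type u} [Field F] (A : Superalgebra F)
    {s t : Grassmann F ⊗[F] A.carrier} (hs : s ∈ envelopeSubmodule A)
    (ht : t ∈ envelopeSubmodule A) : s * t ∈ envelopeSubmodule A := by
  unfold envelopeSubmodule at hs ht ⊢
  induction hs using Submodule.span_induction with
  | zero => rw [zero_mul]; exact Submodule.zero_mem _
  | add p q _ _ hp hq => rw [add_mul]; exact Submodule.add_mem _ hp hq
  | smul c p _ hp => rw [smul_mul_assoc]; exact Submodule.smul_mem _ _ hp
  | mem p hp =>
    obtain ⟨i, g, hg, a, ha, rfl⟩ := hp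
    induction ht using Submodule.span_induction with
    | zero => rw [mul_zero]; exact Submodule.zero_mem _
    | add p q _ _ hp hq => rw [mul_add]; exact Submodule.add_mem _ hp hq
    | smul c p _ hp => rw [mul_smul_comm]; exact Submodule.smul_mem _ _ hp
    | mem q hq =>
      obtain ⟨j, h, hh, b, hb, rfl⟩ := hq
      rw [Algebra.TensorProduct.tmul_mul_tmul]
      exact Submodule.subset_span ⟨i + j, g * h,
        SetLike.mul_mem_graded (A := CliffordAlgebra.evenOdd (0 : QuadraticForm F (ℕ →₀ F))) hg hh,
        a * b, A.mul_mem i j a b ha hb, rfl⟩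

/-- The Grassmann envelope `G(A) = G₀ ⊗ A₀ + G₁ ⊗ A₁`, a subalgebra of `G ⊗ A`. -/
def envelope {F : Type u} [Field F] (A : Superalgebra F) :
    NonUnitalSubalgebra F (Grassmann F ⊗[F] A.carrier) :=
  { envelopeSubmodule A with mul_mem' := envelopeSubmodule_mul_mem A }

/-- The superalgebra `A` satisfies the superidentity corresponding to the multilinear polynomial
`f`, that is, its Grassmann envelope satisfies `f = 0`. -/
def SatisfiesSuperidentity {F : Type u} [Field F] (f : NAPoly F) (A : Superalgebra F) : Prop :=
  SatisfiesIdentity f (envelope A)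

/-- The class of all `V`-superalgebras, where `V` is the variety defined by `S`: the superalgebras
whose Grassmann envelope lies in `V`. -/
def superalgebrasOf {F : Type u} [Field F] (S : Set (NAPoly F)) : Set (Superalgebra F) :=
  {A | InVariety S (envelope A)}

/-- The supervariety generated by `A`: all superalgebras that satisfy every superidentity
of `A`. -/
def generatedSupervariety {F : Type u} [Field F] (A : Superalgebra F) : Set (Superalgebra F) :=
  {B | ∀ f : NAPoly F, IsMultilinear f → SatisfiesSuperidentity f A → SatisfiesSuperidentity f B}

/-! ### Free superalgebras of a variety -/

/-- The parity of a generator: the first `r` generators are even, the other `s` are odd. -/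
def genParity {r s : ℕ} : Fin r ⊕ Fin s → ZMod 2
  | .inl _ => 0
  | .inr _ => 1

/-- The parity of a nonassociative word in even and odd generators. -/
def wordParity {r s : ℕ} : FreeMagma (Fin r ⊕ Fin s) → ZMod 2
  | .of z => genParity z
  | .mul a b => wordParity a + wordParity b

/-- The free nonassociative algebra on `r` even and `s` odd generators. -/
abbrev FreeNA (F : Type u) [Field F] (r s : ℕ) : Type u :=
  FreeNonUnitalNonAssocAlgebra F (Fin r ⊕ Fin s)

/-- The even and the odd part of `FreeNA F r s`: the span of the even or odd words. -/
def freePart (F : Type u) [Field F] (r s : ℕ) (i : ZMod 2) : Submodule F (FreeNA F r s) :=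
  Submodule.span F (MonoidAlgebra.ofMagma F (FreeMagma (Fin r ⊕ Fin s)) '' {w | wordParity w = i})

/-- Two elements of the free nonassociative algebra on `r` even and `s` odd generators are
identified if they take the same value under every substitution of even elements for the even and
odd elements for the odd generators in every `V`-superalgebra. -/
def freeCon {F : Type u} [Field F] (S : Set (NAPoly F)) (r s : ℕ) : RingCon (FreeNA F r s) where
  r p q := ∀ B ∈ superalgebrasOf S, ∀ b : Fin r ⊕ Fin s → B.carrier,
    (∀ z, b z ∈ B.part (genParity z)) →
      FreeNonUnitalNonAssocAlgebra.lift F b p = FreeNonUnitalNonAssocAlgebra.lift F b q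
  iseqv :=
    ⟨fun _ _ _ _ _ => rfl, fun h B hB b hb => (h B hB b hb).symm,
      fun h h' B hB b hb => (h B hB b hb).trans (h' B hB b hb)⟩
  add' h h' B hB b hb := by rw [map_add, map_add, h B hB b hb, h' B hB b hb]
  mul' h h' B hB b hb := by rw [map_mul, map_mul, h B hB b hb, h' B hB b hb]

/-- The underlying algebra of the free `V`-superalgebra on `r` even and `s` odd generators. -/
abbrev FreeCarrier {F : Type u} [Field F] (S : Set (NAPoly F)) (r s : ℕ) : Type u :=
  (freeCon S r s).Quotient

instance freeSMul {F : Type u} [Field F] (S : Set (NAPoly F)) (r s : ℕ) :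
    SMul F (FreeCarrier S r s) where
  smul c := Quotient.map' (fun p => c • p) fun p q (h : freeCon S r s p q) B hB b hb => by
    rw [map_smul, map_smul, h B hB b hb]

instance freeModule {F : Type u} [Field F] (S : Set (NAPoly F)) (r s : ℕ) :
    Module F (FreeCarrier S r s) :=
  Function.Surjective.module F
    (⟨⟨fun p => (p : FreeCarrier S r s), rfl⟩, fun _ _ => rfl⟩ : FreeNA F r s →+ FreeCarrier S r s)
    Quotient.mk''_surjective fun _ _ => rfl

instance freeTower {F : Type u} [Field F] (S : Set (NAPoly F)) (r s : ℕ) :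
    IsScalarTower F (FreeCarrier S r s) (FreeCarrier S r s) where
  smul_assoc c := by
    rintro ⟨p⟩ ⟨q⟩
    exact congrArg (fun t : FreeNA F r s => (t : FreeCarrier S r s)) (smul_mul_assoc c p q)

instance freeComm {F : Type u} [Field F] (S : Set (NAPoly F)) (r s : ℕ) :
    SMulCommClass F (FreeCarrier S r s) (FreeCarrier S r s) where
  smul_comm c := by
    rintro ⟨p⟩ ⟨q⟩
    exact congrArg (fun t : FreeNA F r s => (t : FreeCarrier S r s)) (mul_smul_comm c p q).symm

/-- The projection of the free nonassociative algebra onto the free `V`-superalgebra. -/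
def freeMk {F : Type u} [Field F] (S : Set (NAPoly F)) (r s : ℕ) :
    FreeNA F r s →ₗ[F] FreeCarrier S r s where
  toFun p := (p : FreeCarrier S r s)
  map_add' _ _ := rfl
  map_smul' _ _ := rfl

theorem lift_mem_part {F : Type u} [Field F] {r s : ℕ} (B : Superalgebra F)
    (b : Fin r ⊕ Fin s → B.carrier) (hb : ∀ z, b z ∈ B.part (genParity z)) (i : ZMod 2)
    (p : FreeNA F r s) (hp : p ∈ freePart F r s i) :
    FreeNonUnitalNonAssocAlgebra.lift F b p ∈ B.part i := by
  have hw : ∀ w : FreeMagma (Fin r ⊕ Fin s), FreeNonUnitalNonAssocAlgebra.lift F b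
      (MonoidAlgebra.ofMagma F (FreeMagma (Fin r ⊕ Fin s)) w) ∈ B.part (wordParity w) := by
    intro w
    induction w with
    | ih1 z =>
      have := FreeNonUnitalNonAssocAlgebra.lift_of_apply (R := F) b z
      exact this.symm ▸ hb z
    | ih2 u w hu hw =>
      rw [map_mul, map_mul]
      exact B.mul_mem _ _ _ _ hu hw
  unfold freePart at hp
  induction hp using Submodule.span_induction with
  | zero => rw [map_zero]; exact Submodule.zero_mem _
  | add p q _ _ hp hq => rw [map_add]; exact Submodule.add_mem _ hp hq
  | smul c p _ hp => rw [map_smul]; exact Submodule.smul_mem _ _ hp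
  | mem p hp =>
    obtain ⟨w, rfl, rfl⟩ := hp
    exact hw w

theorem freePart_mul_mem {F : Type u} [Field F] {r s : ℕ} (i j : ZMod 2) (p q : FreeNA F r s)
    (hp : p ∈ freePart F r s i) (hq : q ∈ freePart F r s j) : p * q ∈ freePart F r s (i + j) := by
  unfold freePart at hp hq ⊢
  induction hp using Submodule.span_induction with
  | zero => rw [zero_mul]; exact Submodule.zero_mem _
  | add p q _ _ hp hq => rw [add_mul]; exact Submodule.add_mem _ hp hq
  | smul c p _ hp => rw [smul_mul_assoc]; exact Submodule.smul_mem _ _ hp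
  | mem p hp =>
    obtain ⟨u, rfl, rfl⟩ := hp
    induction hq using Submodule.span_induction with
    | zero => rw [mul_zero]; exact Submodule.zero_mem _
    | add p q _ _ hp hq => rw [mul_add]; exact Submodule.add_mem _ hp hq
    | smul c p _ hp => rw [mul_smul_comm]; exact Submodule.smul_mem _ _ hp
    | mem q hq =>
      obtain ⟨w, rfl, rfl⟩ := hq
      rw [← map_mul]
      exact Submodule.subset_span ⟨u * w, rfl, rfl⟩

theorem freePart_sup {F : Type u} [Field F] (r s : ℕ) :
    freePart F r s 0 ⊔ freePart F r s 1 = ⊤ := by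
  rw [eq_top_iff]
  intro p _
  induction p using MonoidAlgebra.induction_linear with
  | zero => exact Submodule.zero_mem _
  | add p q hp hq => exact Submodule.add_mem _ (hp trivial) (hq trivial)
  | single w c =>
    have h1 : MonoidAlgebra.single w c
        = c • MonoidAlgebra.ofMagma F (FreeMagma (Fin r ⊕ Fin s)) w := by simp
    rw [h1]
    refine Submodule.smul_mem _ _ ?_
    have h2 : ∀ k : ZMod 2, k = 0 ∨ k = 1 := by decide
    rcases h2 (wordParity w) with h | h
    · exact Submodule.mem_sup_left (Submodule.subset_span ⟨w, h, rfl⟩)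
    · exact Submodule.mem_sup_right (Submodule.subset_span ⟨w, h, rfl⟩)

/-- The free `V`-superalgebra on `r` even and `s` odd generators, where `V` is the variety defined
by `S`. For `(r, s) = (0, 0)` this is the zero superalgebra. -/
def freeSuperalgebra {F : Type u} [Field F] (S : Set (NAPoly F)) (r s : ℕ) : Superalgebra F where
  carrier := FreeCarrier S r s
  part i := (freePart F r s i).map (freeMk S r s)
  isCompl := by
    constructor
    · rw [Submodule.disjoint_def]
      rintro _ ⟨p, hp, rfl⟩ ⟨q, hq, hqp⟩
      have hc : freeCon S r s q p := (RingCon.eq _).1 hqp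
      have hp0 : freeCon S r s p 0 := by
        intro B hB b hb
        rw [map_zero]
        refine (Submodule.disjoint_def.1 B.isCompl.disjoint) _ (lift_mem_part B b hb 0 p hp) ?_
        rw [← hc B hB b hb]
        exact lift_mem_part B b hb 1 q hq
      exact (RingCon.eq _).2 hp0
    · rw [codisjoint_iff, ← Submodule.map_sup, freePart_sup, Submodule.map_top,
        LinearMap.range_eq_top]
      exact Quotient.mk''_surjective
  mul_mem := by
    rintro i j _ _ ⟨p, hp, rfl⟩ ⟨q, hq, rfl⟩
    exact ⟨p * q, freePart_mul_mem i j p q hp hq, rfl⟩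

/-! ### Basic superranks -/

/-- The supervariety `V_{r,s}` generated by the free `V`-superalgebra on `r` even and `s` odd
generators. -/
def superrankVariety {F : Type u} [Field F] (S : Set (NAPoly F)) (r s : ℕ) :
    Set (Superalgebra F) :=
  generatedSupervariety (freeSuperalgebra S r s)

/-- The basic spectrum of the variety `V` defined by `S`: the set of its basic superranks, that is,
of the pairs `(r, s)` with `V_{r,s}` equal to the class of all `V`-superalgebras that are minimal
for the componentwise order. -/
def basicSpectrum {F : Type u} [Field F] (S : Set (NAPoly F)) : Set (ℕ × ℕ) :=
  {p | Minimal (fun q : ℕ × ℕ => superrankVariety S q.1 q.2 = superalgebrasOf S) p}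

end Superrank

end

/-! The proof bounds the multilinear elements of a metabelian Malcev algebra from above and detects
them on two small superalgebras.

By anticommutativity and metabelianity, every word of degree at least two is an integer multiple of
a left-normed product `(a i * a j) * …`. Substituting a product `p * q` into the linearized Malcev
identity gives `p q x y z = p q y z x` (`IsMetabelianMalcev.cyclic`). Hence, behind the first two
factors, the half-sum over a transposition of two neighbours is symmetric in all the remaining
factors and the half-difference is alternating in all of them. A left-normed product is therefore
the sum of a symmetric part `W i j` and a signed alternating part `L i j`, which depend only on the
first two indices. The Malcev identity makes `W` a skew cocycle, so that `W i j = p i - p j`, and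
makes `L` symmetric with `L i j + L k m = L i k + L j m`, so that `L i j = v i + v j`
(`exists_leftNormed_eq`). The value of a multilinear `f` of degree `n` is thus a combination of `2 *
n` elements `p k`, `v k`, with coefficients read off from `f` alone.

Each coefficient is visible on a superalgebra generated by one even and one odd element. In
`LieModel` an even `d` acts on an odd `s`; putting a multiple of `s` for the variable `k` and `d`
for the others isolates the coefficient of `p k`. In `SkewModel` an odd `d` acts and the generator
`s` is even; the analogous point isolates the coefficient of `v k`, the sign being produced by the
Grassmann generators. If `f` vanishes on the free superalgebra on one even and one odd generator,
then all coefficients vanish, and `f` is a superidentity of every superalgebra of the variety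
(`superalgebrasOf_subset`). The opposite inclusion holds for every `(r, s)`, because in
characteristic zero the defining identities are equivalent to multilinear ones.

Neither parity can be omitted. With `r` even generators only, a polynomial alternating in more than
`r` variables vanishes: a product in one of these places gives zero by metabelianity, and otherwise
two places contain the same generator with commuting coefficients. `SkewModel` does not satisfy that
polynomial. With odd generators only, symmetric polynomials and `LieModel` play these roles. So `(1,
1)` lies below every pair that generates the whole class, and it is itself such a pair. -/

noncomputable section

namespace Superrank

/-! ### The Grassmann algebra -/

section Grassmann

variable {F : Type u} [Field F]

/-- The generators of the Grassmann algebra. -/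
def gen (F : Type u) [Field F] (k : ℕ) : Grassmann F :=
  ExteriorAlgebra.ι F (Finsupp.single k 1)

theorem ι_mul_ι_swap (v w : ℕ →₀ F) :
    ExteriorAlgebra.ι F v * ExteriorAlgebra.ι F w
      = -(ExteriorAlgebra.ι F w * ExteriorAlgebra.ι F v) :=
  eq_neg_of_add_eq_zero_left (ExteriorAlgebra.ι_add_mul_swap v w)

/-- Moving a generator past a pair of generators changes the sign twice. -/
theorem even_commute_ι {g : Grassmann F} (hg : g ∈ grassmannPart F 0) (v : ℕ →₀ F) :
    g * ExteriorAlgebra.ι F v = ExteriorAlgebra.ι F v * g := by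
  unfold grassmannPart at hg
  induction g, hg using CliffordAlgebra.even_induction with
  | algebraMap r => exact Algebra.commutes r _
  | add x y hx hy ihx ihy => rw [add_mul, mul_add, ihx, ihy]
  | ι_mul_ι_mul a b x hx ih =>
    change ExteriorAlgebra.ι F a * ExteriorAlgebra.ι F b * x * ExteriorAlgebra.ι F v
      = ExteriorAlgebra.ι F v * (ExteriorAlgebra.ι F a * ExteriorAlgebra.ι F b * x)
    rw [mul_assoc, ih, ← mul_assoc, mul_assoc (ExteriorAlgebra.ι F a), ι_mul_ι_swap b v,
      mul_neg, ← mul_assoc, ι_mul_ι_swap a v]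
    simp only [neg_mul, neg_neg, mul_assoc]

theorem even_central {g : Grassmann F} (hg : g ∈ grassmannPart F 0) (h : Grassmann F) :
    g * h = h * g := by
  induction h using ExteriorAlgebra.induction with
  | algebraMap r => exact (Algebra.commutes r g).symm
  | ι v => exact even_commute_ι hg v
  | mul a b ha hb => rw [← mul_assoc, ha, mul_assoc, hb, mul_assoc]
  | add a b ha hb => rw [mul_add, add_mul, ha, hb]

theorem odd_anticommute_ι {g : Grassmann F} (hg : g ∈ grassmannPart F 1) (v : ℕ →₀ F) :
    g * ExteriorAlgebra.ι F v = -(ExteriorAlgebra.ι F v * g) := by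
  unfold grassmannPart at hg
  induction g, hg using CliffordAlgebra.odd_induction with
  | ι a => exact ι_mul_ι_swap a v
  | add x y hx hy ihx ihy => rw [add_mul, mul_add, ihx, ihy, neg_add]
  | ι_mul_ι_mul a b x hx ih =>
    change ExteriorAlgebra.ι F a * ExteriorAlgebra.ι F b * x * ExteriorAlgebra.ι F v
      = -(ExteriorAlgebra.ι F v * (ExteriorAlgebra.ι F a * ExteriorAlgebra.ι F b * x))
    rw [mul_assoc, ih, mul_neg, ← mul_assoc, mul_assoc (ExteriorAlgebra.ι F a), ι_mul_ι_swap b v,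
      mul_neg, ← mul_assoc, ι_mul_ι_swap a v]
    simp only [neg_mul, neg_neg, mul_assoc]

theorem odd_anticommute {g h : Grassmann F} (hg : g ∈ grassmannPart F 1)
    (hh : h ∈ grassmannPart F 1) : g * h = -(h * g) := by
  unfold grassmannPart at hh
  induction h, hh using CliffordAlgebra.odd_induction with
  | ι a => exact odd_anticommute_ι hg a
  | add x y hx hy ihx ihy => rw [add_mul, mul_add, ihx, ihy, neg_add]
  | ι_mul_ι_mul a b x hx ih =>
    change g * (ExteriorAlgebra.ι F a * ExteriorAlgebra.ι F b * x)
      = -(ExteriorAlgebra.ι F a * ExteriorAlgebra.ι F b * x * g)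
    rw [mul_assoc _ x g, ← mul_neg, ← ih, ← mul_assoc, ← mul_assoc, odd_anticommute_ι hg a, neg_mul,
      mul_assoc (ExteriorAlgebra.ι F a), odd_anticommute_ι hg b]
    simp only [mul_neg, neg_neg, mul_assoc]

theorem one_mem_even : (1 : Grassmann F) ∈ grassmannPart F 0 := 
  SetLike.GradedOne.one_mem (A := CliffordAlgebra.evenOdd (0 : QuadraticForm F (ℕ →₀ F)))

theorem gen_mem_odd (k : ℕ) : gen F k ∈ grassmannPart F 1 :=
  CliffordAlgebra.ι_mem_evenOdd_one _ _

theorem gen_swap (i j : ℕ) : gen F i * gen F j = -(gen F j * gen F i) := ι_mul_ι_swap _ _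

/-- The determinant in the coordinates listed in `l` extends to a functional on the exterior
algebra, and on this product it is the determinant of the identity matrix. -/
theorem prod_gen_ne_zero {l : List ℕ} (hl : l.Nodup) : (l.map (gen F)).prod ≠ 0 := by
  have h1 : (l.map (gen F)).prod
      = ExteriorAlgebra.ιMulti F l.length (fun i => Finsupp.single (l.get i) (1 : F)) := by
    rw [ExteriorAlgebra.ιMulti_apply]
    congr 1
    conv_lhs => rw [← List.ofFn_get l, List.map_ofFn]
    rfl
  intro h0
  let π : (ℕ →₀ F) →ₗ[F] (Fin l.length → F) := LinearMap.pi fun i => Finsupp.lapply (l.get i)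
  -- The family of alternating maps is the determinant in degree `l.length` and zero in all other
  -- degrees.
  have h2 := ExteriorAlgebra.liftAlternating_apply_ιMulti (R := F)
    (fun n => if h : l.length = n then
      ((Matrix.detRowAlternating (R := F) (n := Fin l.length)).compLinearMap π).domDomCongr
        (finCongr h) else 0) (fun i => Finsupp.single (l.get i) (1 : F))
  rw [← h1, h0, map_zero] at h2
  have h3 : (fun i => π (Finsupp.single (l.get i) (1 : F))) = (1 : Matrix _ _ F) := by
    funext i j
    simp only [π, LinearMap.pi_apply, Finsupp.lapply_apply, Finsupp.single_apply, Matrix.one_apply]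
    simp only [hl.get_inj_iff]
  rw [dif_pos rfl] at h2
  have h4 : Matrix.det (fun i => π (Finsupp.single (l.get i) (1 : F))) = 0 := h2.symm
  rw [h3, Matrix.det_one] at h4
  exact one_ne_zero h4

end Grassmann

/-! ### Identities of metabelian Malcev algebras -/

/-- The identities of metabelian Malcev algebras, stated for elements. -/
structure IsMetabelianMalcev (A : Type v) [NonUnitalNonAssocRing A] : Prop where
  anticomm : ∀ a b : A, a * b = -(b * a)
  malcev : ∀ x y z : A, jacobian x y z * x = jacobian x y (x * z)
  metabelian : ∀ a b c d : A, (a * b) * (c * d) = 0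

theorem lift_var {F : Type u} [Field F] {A : Type v} [NonUnitalNonAssocRing A]
    [Module F A] [IsScalarTower F A A] [SMulCommClass F A A] (a : ℕ → A) (i : ℕ) :
    FreeNonUnitalNonAssocAlgebra.lift F a (var F i) = a i :=
  FreeNonUnitalNonAssocAlgebra.lift_of_apply (R := F) a i

theorem inVariety_iff {F : Type u} [Field F] {A : Type v} [NonUnitalNonAssocRing A]
    [Module F A] [IsScalarTower F A A] [SMulCommClass F A A] :
    InVariety (malcev F ∪ metabelian F) A ↔ IsMetabelianMalcev A := by
  constructor
  · intro h
    refine ⟨fun a b => ?_, fun x y z => ?_, fun a b c d => ?_⟩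
    · have := h _ (Or.inl (Or.inl rfl)) (fun i => if i = 0 then a else b)
      simp only [map_add, map_mul, lift_var] at this
      exact eq_neg_of_add_eq_zero_left this
    · have := h _ (Or.inl (Or.inr rfl)) (fun i => if i = 0 then x else if i = 1 then y else z)
      simp only [jacobian, map_sub, map_add, map_mul, lift_var] at this
      exact sub_eq_zero.1 this
    · have := h _ (Or.inr rfl)
        (fun i => if i = 0 then a else if i = 1 then b else if i = 2 then c else d)
      simp only [map_mul, lift_var] at this
      exact this
  · rintro ⟨h1, h2, h3⟩ f ((rfl | rfl) | rfl) a
    · simp only [map_add, map_mul, lift_var]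
      rw [h1, neg_add_cancel]
    · have := h2 (a 0) (a 1) (a 2)
      simp only [jacobian] at this
      simp only [jacobian, map_sub, map_add, map_mul, lift_var]
      exact sub_eq_zero.2 this
    · simp only [map_mul, lift_var]
      exact h3 _ _ _ _

/-! ### Left-normed products and the cyclic law -/

section LeftNormed

variable {A : Type v} [NonUnitalNonAssocRing A]

/-- The left-normed product of `w` with the elements of a list. -/
def leftNormed (w : A) (l : List A) : A := l.foldl (· * ·) w

@[simp] theorem leftNormed_nil (w : A) : leftNormed w [] = w := rfl

@[simp] theorem leftNormed_cons (w x : A) (l : List A) :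
    leftNormed w (x :: l) = leftNormed (w * x) l := rfl

theorem leftNormed_append (w : A) (l l' : List A) :
    leftNormed w (l ++ l') = leftNormed (leftNormed w l) l' := List.foldl_append

theorem leftNormed_add (w w' : A) (l : List A) :
    leftNormed (w + w') l = leftNormed w l + leftNormed w' l := by
  induction l generalizing w w' with
  | nil => rfl
  | cons x l ih => simp only [leftNormed_cons, add_mul, ih]

@[simp] theorem leftNormed_zero (l : List A) : leftNormed (0 : A) l = 0 := by
  induction l with
  | nil => rfl
  | cons x l ih => simp only [leftNormed_cons, zero_mul, ih]

theorem leftNormed_neg (w : A) (l : List A) : leftNormed (-w) l = -leftNormed w l := by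
  rw [eq_neg_iff_add_eq_zero, ← leftNormed_add, neg_add_cancel, leftNormed_zero]

/-- The left-normed product symmetrized (`δ = 1`) or alternated (`δ = -1`) in the first two
elements of the list; lists with fewer than two elements are treated so that the sum of both is
twice the left-normed product. -/
def polarized (δ : ℤ) (w : A) : List A → A
  | [] => (1 + δ) • w
  | [x] => (1 - δ) • (w * x)
  | x :: y :: l => leftNormed (w * x * y + δ • (w * y * x)) l

theorem polarized_add_polarized (w : A) (l : List A) :
    polarized 1 w l + polarized (-1) w l = (2 : ℤ) • leftNormed w l := by
  match l with
  | [] => simp [polarized]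
  | [x] => simp [polarized]
  | x :: y :: l =>
    simp only [polarized, leftNormed_cons]
    rw [← leftNormed_add, two_smul, ← leftNormed_add]
    congr 1
    module

namespace IsMetabelianMalcev

variable (hA : IsMetabelianMalcev A)
include hA

/-- The linearized Malcev identity in a metabelian Malcev algebra. -/
theorem linearized (x t y z : A) :
    x * y * z * t + t * y * z * x + y * z * x * t + y * z * t * x
      - x * z * t * y - t * z * x * y = 0 := by
  have h1 := hA.malcev (x + t) y z
  have h2 := hA.malcev x y z
  have h3 := hA.malcev t y z
  have e1 : y * (x * z) * t = -(x * z * y * t) := by rw [hA.anticomm y, neg_mul]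
  have e2 : y * (t * z) * x = -(t * z * y * x) := by rw [hA.anticomm y, neg_mul]
  have e3 : z * x * y * t = -(x * z * y * t) := by rw [hA.anticomm z x, neg_mul, neg_mul]
  have e4 : z * t * y * x = -(t * z * y * x) := by rw [hA.anticomm z t, neg_mul, neg_mul]
  simp only [jacobian, add_mul, mul_add, hA.metabelian, zero_add, add_zero] at h1 h2 h3
  rw [e1, e2, e3, e4] at h1
  have h4 := congrArg₂ (· - ·) h1 (congrArg₂ (· + ·) h2 h3)
  refine Eq.trans ?_ (sub_eq_zero.2 h4)
  abel

/-- With a product in the place of one variable of the linearized Malcev identity, metabelianity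
kills all but two of its terms. -/
theorem cyclic (p q x y z : A) : p * q * x * y * z = p * q * y * z * x := by
  have h := hA.linearized (p * q) z x y
  have e1 : z * x * y * (p * q) = 0 := hA.metabelian _ _ _ _
  have e2 : x * y * (p * q) = 0 := hA.metabelian _ _ _ _
  have e3 : x * y * z * (p * q) = 0 := hA.metabelian _ _ _ _
  have e4 : z * y * (p * q) = 0 := hA.metabelian _ _ _ _
  rw [e1, e2, e3, e4, zero_mul, zero_mul, add_zero, add_zero, add_zero, sub_zero] at h
  exact sub_eq_zero.1 h

/-- By `cyclic`, the polarized transposition can be moved one place to the right. This is what turns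
polarization in two neighbouring factors into full symmetry or skew symmetry in the whole list. -/
theorem polarized_cons (δ : ℤ) (p q x : A) {l : List A} (hl : 2 ≤ l.length) :
    polarized δ (p * q) (x :: l) = polarized δ (p * q * x) l := by
  match l, hl with
  | y :: z :: l, _ =>
    simp only [polarized, leftNormed_cons, add_mul, smul_mul_assoc]
    rw [hA.cyclic p q y x z]

end IsMetabelianMalcev

end LeftNormed

/-! ### Signs of lists of natural numbers -/

/-- The sign of the ordered pair `(i, j)`. -/
def pairSign (i j : ℕ) : ℤ := if i < j then 1 else -1

/-- The sign of a list: the product of the signs of its pairs. -/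
def listSign : List ℕ → ℤ
  | [] => 1
  | i :: l => (l.map (pairSign i)).prod * listSign l

theorem pairSign_swap {i j : ℕ} (h : i ≠ j) : pairSign j i = -pairSign i j := by
  unfold pairSign
  rcases lt_or_gt_of_ne h with h | h
  · rw [if_pos h, if_neg h.not_gt]
  · rw [if_pos h, if_neg h.not_gt, neg_neg]

theorem prod_pairSign_mul_self (i : ℕ) (l : List ℕ) :
    (l.map (pairSign i)).prod * (l.map (pairSign i)).prod = 1 := by
  induction l with
  | nil => rfl
  | cons j l ih =>
    have : pairSign i j * pairSign i j = 1 := by unfold pairSign; split_ifs <;> rfl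
    rw [List.map_cons, List.prod_cons, mul_mul_mul_comm, this, ih, one_mul]

theorem listSign_mul_self (l : List ℕ) : listSign l * listSign l = 1 := by
  induction l with
  | nil => rfl
  | cons i l ih => rw [listSign, mul_mul_mul_comm, prod_pairSign_mul_self, ih, one_mul]

theorem listSign_swap {i j : ℕ} (h : i ≠ j) (l : List ℕ) :
    listSign (j :: i :: l) = -listSign (i :: j :: l) := by
  simp only [listSign, List.map_cons, List.prod_cons, pairSign_swap h]
  ring

theorem smul_listSign_smul {M : Type*} [AddCommGroup M] (l : List ℕ) (m : M) :
    listSign l • listSign l • m = m := by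
  rw [smul_smul, listSign_mul_self, one_smul]

/-- The alternated left-normed product changes under a permutation by the sign. -/
theorem listSign_smul_eq_of_perm {A : Type v} [NonUnitalNonAssocRing A] (hA : IsMetabelianMalcev A)
    (a : ℕ → A) {l l' : List ℕ} (h : l.Perm l') (hl : l.Nodup) (p q : A) :
    listSign l • polarized (-1) (p * q) (l.map a)
      = listSign l' • polarized (-1) (p * q) (l'.map a) := by
  induction h generalizing p q with
  | nil => rfl
  | @cons x l l' h ih =>
    by_cases h2 : 2 ≤ l.length
    · have h2' : 2 ≤ l'.length := h.length_eq ▸ h2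
      have := ih (List.nodup_cons.1 hl).2 (p * q) (a x)
      rw [List.map_cons, List.map_cons, hA.polarized_cons _ _ _ _ (by simpa using h2),
        hA.polarized_cons _ _ _ _ (by simpa using h2'), listSign, listSign, mul_smul, mul_smul, this,
        (h.map (pairSign x)).prod_eq]
    -- A list with at most one element has no nontrivial permutation.
    · match l, h2, h with
      | [], _, h => rw [h.nil_eq]
      | [y], _, h => rw [List.singleton_perm.1 h]
      | _ :: _ :: _, h2, _ => simp at h2
  | swap x y l =>
    have hxy : x ≠ y := by
      rintro rfl
      simp at hl
    rw [listSign_swap hxy, neg_smul, ← smul_neg]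
    simp only [List.map_cons, polarized]
    rw [← leftNormed_neg]
    congr 2
    module
  | trans h1 _ ih1 ih2 => rw [ih1 hl, ih2 (h1.nodup_iff.1 hl)]

theorem polarized_one_eq_of_perm {A : Type v} [NonUnitalNonAssocRing A] (hA : IsMetabelianMalcev A)
    {l l' : List A} (h : l.Perm l') (p q : A) :
    polarized 1 (p * q) l = polarized 1 (p * q) l' := by
  induction h generalizing p q with
  | nil => rfl
  | @cons x l l' h ih =>
    by_cases h2 : 2 ≤ l.length
    · rw [hA.polarized_cons _ _ _ _ h2, hA.polarized_cons _ _ _ _ (h.length_eq ▸ h2), ih]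
    · match l, h2, h with
      | [], _, h => rw [h.nil_eq]
      | [y], _, h => rw [List.singleton_perm.1 h]
      | _ :: _ :: _, h2, _ => simp at h2
  | swap x y l =>
    simp only [polarized, one_smul]
    rw [add_comm]
  | trans h1 _ ih1 ih2 => rw [ih1, ih2]

/-! ### The multilinear elements of a metabelian Malcev algebra -/

/-- Adding to the linearized Malcev identity its copy with `y` and `z` interchanged cancels the
terms that begin with `y * z`. What remains is the exchange relation for the alternating parts. -/
theorem IsMetabelianMalcev.alternating_exchange {A : Type v} [NonUnitalNonAssocRing A]
    (hA : IsMetabelianMalcev A) (x y z t : A) :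
    (x * y * z * t - x * y * t * z) + (z * t * x * y - z * t * y * x)
      + (x * z * y * t - x * z * t * y) + (y * t * x * z - y * t * z * x) = 0 := by
  have h1 := hA.linearized x t y z
  have h2 := hA.linearized x t z y
  simp only [hA.anticomm z y, hA.anticomm t y, hA.anticomm t z, neg_mul] at h1 h2
  have e := congrArg₂ (· + ·) h1 h2
  refine Eq.trans ?_ (e.trans (by simp))
  abel

section Spanning

variable {F : Type u} [Field F] [CharZero F] {A : Type v} [NonUnitalNonAssocRing A] [Module F A]

/-- Skew-symmetrizing the linearized identity in two variables and summing cyclically over `x`, `y`,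
`z` gives four times this relation: the Jacobi identity holds after symmetrization in the following
two factors. -/
theorem IsMetabelianMalcev.symmetric_jacobi (F : Type u) [Field F] [CharZero F]
    {A : Type v} [NonUnitalNonAssocRing A] [Module F A]
    (hA : IsMetabelianMalcev A) (x y z t : A) :
    (x * y * z * t + x * y * t * z) + (y * z * x * t + y * z * t * x)
      + (z * x * y * t + z * x * t * y) = 0 := by
  have h1 := hA.linearized x t y z
  have h2 := hA.linearized x t z y
  have h3 := hA.linearized y t z x
  have h4 := hA.linearized y t x z
  have h5 := hA.linearized z t x y
  have h6 := hA.linearized z t y x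
  simp only [hA.anticomm y x, hA.anticomm z y, hA.anticomm x z, hA.anticomm t x, hA.anticomm t y,
    hA.anticomm t z, neg_mul] at h1 h2 h3 h4 h5 h6
  have h : (4 : F) • ((x * y * z * t + x * y * t * z) + (y * z * x * t + y * z * t * x)
      + (z * x * y * t + z * x * t * y)) = 0 := by
    have e := congrArg₂ (· + ·) (congrArg₂ (· - ·) h1 h2)
      (congrArg₂ (· + ·) (congrArg₂ (· - ·) h3 h4) (congrArg₂ (· - ·) h5 h6))
    refine Eq.trans ?_ (e.trans (by simp))
    module
  exact (smul_eq_zero.1 h).resolve_left (by norm_num)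


/-- The indices below `n` other than `i` and `j`, in increasing order. -/
def restList (n i j : ℕ) : List ℕ := ((List.range n).erase i).erase j

theorem restList_comm (n i j : ℕ) : restList n i j = restList n j i := List.erase_comm _ _

theorem perm_restList {n i j : ℕ} {l : List ℕ} (h : (i :: j :: l).Perm (List.range n)) :
    l.Perm (restList n i j) := by
  have h1 := (h.erase i).erase j
  rwa [List.erase_cons_head, List.erase_cons_head] at h1

theorem range_perm_cons_cons {n i j : ℕ} (hi : i < n) (hj : j < n) (hij : i ≠ j) :
    (i :: j :: restList n i j).Perm (List.range n) := by
  have h1 := List.perm_cons_erase (List.mem_range.2 hi)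
  have h2 := List.perm_cons_erase ((List.mem_erase_of_ne hij.symm).2 (List.mem_range.2 hj))
  exact (h1.trans (h2.cons i)).symm

theorem range_perm_three {n i j k : ℕ} (hi : i < n) (hj : j < n) (hk : k < n) (hij : i ≠ j)
    (hik : i ≠ k) (hjk : j ≠ k) :
    ∃ q, (i :: j :: k :: q).Perm (List.range n) := by
  have hmem : k ∈ restList n i j := (List.mem_erase_of_ne hjk.symm).2
    ((List.mem_erase_of_ne hik.symm).2 (List.mem_range.2 hk))
  exact ⟨_, (((List.perm_cons_erase hmem).symm.cons j).cons i).trans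
    (range_perm_cons_cons hi hj hij)⟩

theorem range_perm_four {n i j k m : ℕ} (hi : i < n) (hj : j < n) (hk : k < n) (hm : m < n)
    (hij : i ≠ j) (hik : i ≠ k) (him : i ≠ m) (hjk : j ≠ k) (hjm : j ≠ m) (hkm : k ≠ m) :
    ∃ q, (i :: j :: k :: m :: q).Perm (List.range n) := by
  obtain ⟨q, hq⟩ := range_perm_three hi hj hk hij hik hjk
  have hmem : m ∈ q := by
    have : m ∈ i :: j :: k :: q := hq.mem_iff.2 (List.mem_range.2 hm)
    simpa [him.symm, hjm.symm, hkm.symm] using this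
  exact ⟨_, ((((List.perm_cons_erase hmem).symm.cons k).cons j).cons i).trans hq⟩

/-- A symmetric function satisfying the exchange relation is a sum of values of a function of one
variable. -/
theorem exists_eq_add_of_exchange {M : Type*} [AddCommGroup M] [Module F M] {n : ℕ} (hn : 3 ≤ n)
    (L : ℕ → ℕ → M) (hsymm : ∀ i j, L i j = L j i)
    (hex : ∀ i j k m, i < n → j < n → k < n → m < n → i ≠ j → i ≠ k → i ≠ m → j ≠ k → j ≠ m →
      k ≠ m → L i j + L k m = L i k + L j m) :
    ∃ v : ℕ → M, ∀ i j, i < n → j < n → i ≠ j → L i j = v i + v j := by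
  -- The value of `v` at `0` is forced: if `L i j = v i + v j`, then the bracket equals `2 • v 0`.
  let v0 : M := (2⁻¹ : F) • (L 0 1 + L 0 2 - L 1 2)
  have h2 : L 0 1 + L 0 2 - L 1 2 = v0 + v0 := by
    simp only [v0, ← add_smul]
    norm_num
  -- Exchange relations through the indices `0`, `1`, `2` express every value by those in row `0`
  -- and by `L 1 2`.
  have key : ∀ i j, i < n → j < n → i ≠ j → i ≠ 0 → j ≠ 0 →
      L i j = L 0 i + L 0 j - (L 0 1 + L 0 2 - L 1 2) := by
    have aux : ∀ i j, i < n → j < n → i ≠ j → i ≠ 0 → j ≠ 0 → i < j →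
        L i j = L 0 i + L 0 j - (L 0 1 + L 0 2 - L 1 2) := by
      intro i j hi hj hij hi0 hj0 hlt
      by_cases hi1 : i = 1
      · subst hi1
        by_cases hj2 : j = 2
        · subst hj2
          abel
        · have h' := hex 0 j 2 1 (by omega) hj (by omega) hi (by omega) (by omega) (by omega)
            (by omega) (by omega) (by omega)
          rw [hsymm 2 1, hsymm j 1] at h'
          have e' : L 1 j = L 0 j + L 1 2 - L 0 2 := eq_sub_of_add_eq' h'.symm
          rw [e']
          abel
      · by_cases hi2 : i = 2
        · subst hi2
          have h' := hex 0 j 1 2 (by omega) hj (by omega) hi (by omega) (by omega) (by omega)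
            (by omega) (by omega) (by omega)
          rw [hsymm j 2] at h'
          have e' : L 2 j = L 0 j + L 1 2 - L 0 1 := eq_sub_of_add_eq' h'.symm
          rw [e']
          abel
        · have h' := hex 0 j 2 1 (by omega) hj (by omega) (by omega) (by omega) (by omega)
            (by omega) (by omega) (by omega) (by omega)
          rw [hsymm 2 1, hsymm j 1] at h'
          have e' : L 1 j = L 0 j + L 1 2 - L 0 2 := eq_sub_of_add_eq' h'.symm
          have h'' := hex 0 i 1 j (by omega) hi (by omega) hj (by omega) (by omega) (by omega)
            (by omega) (by omega) (by omega)
          have e'' : L i j = L 0 i + L 1 j - L 0 1 := eq_sub_of_add_eq' h''.symm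
          rw [e'', e']
          abel
    intro i j hi hj hij hi0 hj0
    rcases lt_or_gt_of_ne hij with h | h
    · exact aux i j hi hj hij hi0 hj0 h
    · rw [hsymm, aux j i hj hi hij.symm hj0 hi0 h, add_comm (L 0 j)]
  refine ⟨fun i => if i = 0 then v0 else L 0 i - v0, fun i j hi hj hij => ?_⟩
  by_cases hi0 : i = 0
  · subst hi0
    simp only [if_true, if_neg hij.symm]
    abel
  · by_cases hj0 : j = 0
    · subst hj0
      simp only [if_true, if_neg hi0]
      rw [hsymm]
      abel
    · simp only [if_neg hi0, if_neg hj0]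
      rw [key i j hi hj hij hi0 hj0, h2]
      abel

/-- The pairs that involve `i` or `j` contribute a factor that does not depend on the order of the
rest, so the sign of the whole list serves as well as that of the tail. -/
theorem listSign_cons_cons_smul_eq_of_perm (hA : IsMetabelianMalcev A) (a : ℕ → A) (i j : ℕ)
    {l l' : List ℕ} (h : l.Perm l') (hl : l.Nodup) (p q : A) :
    listSign (i :: j :: l) • polarized (-1) (p * q) (l.map a)
      = listSign (i :: j :: l') • polarized (-1) (p * q) (l'.map a) := by
  simp only [listSign, mul_smul, listSign_smul_eq_of_perm hA a h hl p q,
    ((h.cons j).map (pairSign i)).prod_eq, (h.map (pairSign j)).prod_eq]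

/-- Every left-normed product of the elements `a 0, …, a (n - 1)` in some order is a combination
of `2 * n` elements, with coefficients that depend only on the order of the factors. -/
theorem exists_leftNormed_eq (F : Type u) [Field F] [CharZero F] [Module F A]
    (hA : IsMetabelianMalcev A) (a : ℕ → A) (n : ℕ) :
    ∃ p v : ℕ → A, ∀ i j l, (i :: j :: l).Perm (List.range n) →
      leftNormed (a i * a j) (l.map a)
        = p i - p j + listSign (i :: j :: l) • (v i + v j) := by
  -- `W` and `L` are the symmetric and the signed alternating half of the product. Both are defined
  -- through the increasing order of the remaining indices, but `hW` and `hL` show that any order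
  -- gives the same value.
  let W : ℕ → ℕ → A := fun i j => (2⁻¹ : F) • polarized 1 (a i * a j) ((restList n i j).map a)
  let L : ℕ → ℕ → A := fun i j => (2⁻¹ : F) •
    listSign (i :: j :: restList n i j) • polarized (-1) (a i * a j) ((restList n i j).map a)
  have hnodup : ∀ {l : List ℕ}, l.Perm (List.range n) → l.Nodup := fun h =>
    h.nodup_iff.2 List.nodup_range
  have hW : ∀ i j l, (i :: j :: l).Perm (List.range n) →
      W i j = (2⁻¹ : F) • polarized 1 (a i * a j) (l.map a) := by
    intro i j l h
    simp only [W]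
    rw [polarized_one_eq_of_perm hA ((perm_restList h).map a)]
  have hL : ∀ i j l, (i :: j :: l).Perm (List.range n) →
      L i j = (2⁻¹ : F) • listSign (i :: j :: l) • polarized (-1) (a i * a j) (l.map a) := by
    intro i j l h
    simp only [L]
    rw [listSign_cons_cons_smul_eq_of_perm hA a i j (perm_restList h)
      (hnodup h).of_cons.of_cons]
  have hsplit : ∀ i j l, (i :: j :: l).Perm (List.range n) →
      leftNormed (a i * a j) (l.map a) = W i j + listSign (i :: j :: l) • L i j := by
    intro i j l h
    rw [hW i j l h, hL i j l h, smul_comm (listSign _), smul_listSign_smul, ← smul_add,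
      polarized_add_polarized, ← Int.cast_smul_eq_zsmul F, smul_smul]
    norm_num
  have hWanti : ∀ i j, W i j = -W j i := by
    intro i j
    simp only [W, restList_comm n i j, hA.anticomm (a i) (a j)]
    rw [← smul_neg]
    congr 1
    match (restList n j i).map a with
    | [] => simp [polarized]
    | [x] => simp [polarized]
    | x :: y :: l =>
      simp only [polarized]
      rw [← leftNormed_neg]
      simp only [neg_mul]
      congr 1
      module
  have hLsymm : ∀ i j, L i j = L j i := by
    intro i j
    by_cases hij : i = j
    · rw [hij]
    simp only [L, restList_comm n i j, hA.anticomm (a i) (a j), listSign_swap (Ne.symm hij)]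
    congr 1
    rw [neg_smul, ← smul_neg]
    congr 1
    match (restList n j i).map a with
    | [] => simp [polarized]
    | [x] => simp [polarized]
    | x :: y :: l =>
      simp only [polarized]
      rw [← leftNormed_neg]
      simp only [neg_mul]
      congr 1
      module
  have hWcocycle : ∀ i j k, i < n → j < n → k < n → i ≠ j → i ≠ k → j ≠ k →
      W i j + W j k + W k i = 0 := by
    intro i j k hi hj hk hij hik hjk
    obtain ⟨q, hq⟩ := range_perm_three hi hj hk hij hik hjk
    have hq2 : (j :: k :: i :: q).Perm (List.range n) :=
      (((List.Perm.swap i k q).cons j).trans (List.Perm.swap i j (k :: q))).trans hq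
    have hq3 : (k :: i :: j :: q).Perm (List.range n) :=
      ((List.Perm.swap i k _).trans ((List.Perm.swap j k q).cons i)).trans hq
    rw [hW i j _ hq, hW j k _ hq2, hW k i _ hq3, ← smul_add, ← smul_add]
    convert smul_zero _
    -- In degree three the cocycle relation for `W` would be the Jacobi identity, which Malcev
    -- algebras need not satisfy. It holds because `polarized 1` is zero on one-element lists, the
    -- whole product being assigned to the alternating part.
    match q with
    | [] => simp [polarized]
    | m :: q =>
      simp only [List.map_cons, polarized, one_smul]
      rw [← leftNormed_add, ← leftNormed_add,
        hA.symmetric_jacobi F (a i) (a j) (a k) (a m), leftNormed_zero]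
  have hLexchange : ∀ i j k m, i < n → j < n → k < n → m < n → i ≠ j → i ≠ k → i ≠ m → j ≠ k →
      j ≠ m → k ≠ m → L i j + L k m = L i k + L j m := by
    intro i j k m hi hj hk hm hij hik him hjk hjm hkm
    obtain ⟨q, hq⟩ := range_perm_four hi hj hk hm hij hik him hjk hjm hkm
    have hq2 : (k :: m :: i :: j :: q).Perm (List.range n) :=
      (List.perm_append_comm (l₁ := [k, m]) (l₂ := [i, j])).append_right q |>.trans hq
    have hq3 : (i :: k :: j :: m :: q).Perm (List.range n) :=
      ((List.Perm.swap j k (m :: q)).cons i).trans hq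
    have hq4 : (j :: m :: i :: k :: q).Perm (List.range n) :=
      ((List.perm_append_comm (l₁ := [j, m]) (l₂ := [i, k])).append_right q).trans
        (((List.Perm.swap j k (m :: q)).cons i).trans hq)
    have s2 : listSign (k :: m :: i :: j :: q) = listSign (i :: j :: k :: m :: q) := by
      simp only [listSign, List.map_cons, List.prod_cons, pairSign_swap hik,
        pairSign_swap him, pairSign_swap hjk, pairSign_swap hjm]
      ring
    have s3 : listSign (i :: k :: j :: m :: q) = -listSign (i :: j :: k :: m :: q) := by
      simp only [listSign, List.map_cons, List.prod_cons, pairSign_swap hjk]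
      ring
    have s4 : listSign (j :: m :: i :: k :: q) = -listSign (i :: j :: k :: m :: q) := by
      simp only [listSign, List.map_cons, List.prod_cons, pairSign_swap hij,
        pairSign_swap him, pairSign_swap hkm]
      ring
    rw [hL i j _ hq, hL k m _ hq2, hL i k _ hq3, hL j m _ hq4, s2, s3, s4, ← smul_add, ← smul_add,
      ← smul_add, ← smul_add]
    congr 1
    rw [neg_smul, ← smul_neg]
    congr 1
    simp only [List.map_cons, polarized]
    rw [← leftNormed_add, ← leftNormed_add, ← leftNormed_neg]
    congr 1
    rw [eq_neg_iff_add_eq_zero, ← hA.alternating_exchange (a i) (a j) (a k) (a m)]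
    module
  -- A skew cocycle is a coboundary; the potential is normalized to be zero at the index `0`.
  have hp : ∀ i j, i < n → j < n → i ≠ j →
      W i j = (if i = 0 then 0 else W i 0) - (if j = 0 then 0 else W j 0) := by
    intro i j hi hj hij
    by_cases hi0 : i = 0
    · subst hi0
      rw [if_pos rfl, if_neg hij.symm, zero_sub]
      exact hWanti 0 j
    · by_cases hj0 : j = 0
      · subst hj0
        rw [if_pos rfl, if_neg hij, sub_zero]
      · rw [if_neg hi0, if_neg hj0]
        have := hWcocycle i j 0 hi hj (by omega) hij hi0 hj0
        rw [hWanti 0 i] at this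
        rw [add_neg_eq_zero] at this
        rw [← this, add_sub_cancel_right]
  have hlt : ∀ {i j l}, (i :: j :: l).Perm (List.range n) → i < n ∧ j < n ∧ i ≠ j := by
    intro i j l h
    refine ⟨List.mem_range.1 (h.mem_iff.1 (by simp)), List.mem_range.1 (h.mem_iff.1 (by simp)), ?_⟩
    rintro rfl
    simpa using hnodup h
  have hv : ∃ v : ℕ → A, ∀ i j l, (i :: j :: l).Perm (List.range n) → L i j = v i + v j := by
    by_cases hn : 3 ≤ n
    · obtain ⟨v, hv⟩ := exists_eq_add_of_exchange (F := F) hn L hLsymm hLexchange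
      exact ⟨v, fun i j l h => hv i j (hlt h).1 (hlt h).2.1 (hlt h).2.2⟩
    -- In degree two the list `l` is empty and `polarized (-1)` is zero on it, so `v = 0` works.
    · refine ⟨0, fun i j l h => ?_⟩
      have hlen := h.length_eq
      simp only [List.length_cons, List.length_range] at hlen
      have : l = [] := List.length_eq_zero_iff.1 (by omega)
      subst this
      rw [hL i j _ h]
      simp [polarized]
  obtain ⟨v, hv⟩ := hv
  refine ⟨fun i => if i = 0 then 0 else W i 0, v, fun i j l h => ?_⟩
  rw [hsplit i j l h, hp i j (hlt h).1 (hlt h).2.1 (hlt h).2.2, hv i j l h]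

end Spanning

/-! ### Coordinates on `G ⊗ B` -/

section Coordinates

variable {F : Type u} [Field F]

/-- The map `G ⊗ M → G` induced by a linear functional on `M`. -/
def coord {M : Type v} [AddCommGroup M] [Module F M] (φ : M →ₗ[F] F) :
    Grassmann F ⊗[F] M →ₗ[F] Grassmann F :=
  (TensorProduct.rid F (Grassmann F)).toLinearMap ∘ₗ LinearMap.lTensor (Grassmann F) φ

@[simp] theorem coord_tmul {M : Type v} [AddCommGroup M] [Module F M] (φ : M →ₗ[F] F)
    (g : Grassmann F) (m : M) : coord φ (g ⊗ₜ[F] m) = φ m • g := by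
  simp [coord]

/-- The two-term shape with a coefficient `c` covers the multiplication rules of both models, with
`c = 1` or `c = -1`. -/
theorem coord_mul {B : Type v} [NonUnitalNonAssocRing B] [Module F B] [IsScalarTower F B B]
    [SMulCommClass F B B] (φ φ₁ φ₂ φ₃ φ₄ : B →ₗ[F] F) (c : F)
    (h : ∀ a b, φ (a * b) = φ₁ a * φ₂ b + c * (φ₃ a * φ₄ b)) (s t : Grassmann F ⊗[F] B) :
    coord φ (s * t) = coord φ₁ s * coord φ₂ t + c • (coord φ₃ s * coord φ₄ t) := by
  induction s with
  | zero => simp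
  | add s s' hs hs' =>
    rw [add_mul, map_add, hs, hs', map_add, map_add, add_mul, add_mul, smul_add]
    abel
  | tmul g a =>
    induction t with
    | zero => simp
    | add t t' ht ht' =>
      rw [mul_add, map_add, ht, ht', map_add, map_add, mul_add, mul_add, smul_add]
      abel
    | tmul g' b =>
      simp only [Algebra.TensorProduct.tmul_mul_tmul, coord_tmul, h, smul_mul_smul_comm, add_smul,
        mul_smul]

theorem coord_mul_eq_zero {B : Type v} [NonUnitalNonAssocRing B] [Module F B] [IsScalarTower F B B]
    [SMulCommClass F B B] (φ : B →ₗ[F] F) (h : ∀ a b, φ (a * b) = 0) (s t : Grassmann F ⊗[F] B) :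
    coord φ (s * t) = 0 := by
  have h' := coord_mul φ φ 0 φ 0 0 (fun a b => by simp [h]) s t
  rw [h']
  simp [coord]

theorem coord_mem {B : Superalgebra F} (φ : B.carrier →ₗ[F] F) (k : ZMod 2)
    (h : ∀ i, i ≠ k → ∀ a ∈ B.part i, φ a = 0) {t : Grassmann F ⊗[F] B.carrier}
    (ht : t ∈ envelope B) : coord φ t ∈ grassmannPart F k := by
  change t ∈ envelopeSubmodule B at ht
  unfold envelopeSubmodule at ht
  induction ht using Submodule.span_induction with
  | zero => rw [map_zero]; exact Submodule.zero_mem _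
  | add p q _ _ hp hq => rw [map_add]; exact Submodule.add_mem _ hp hq
  | smul c p _ hp => rw [map_smul]; exact Submodule.smul_mem _ _ hp
  | mem p hp =>
    obtain ⟨i, g, hg, a, ha, rfl⟩ := hp
    rw [coord_tmul]
    by_cases hi : i = k
    · subst hi
      exact Submodule.smul_mem _ _ hg
    · rw [h i hi a ha, zero_smul]
      exact Submodule.zero_mem _

theorem tmul_mem_envelope {B : Superalgebra F} {i : ZMod 2} {g : Grassmann F}
    (hg : g ∈ grassmannPart F i) {a : B.carrier} (ha : a ∈ B.part i) : g ⊗ₜ[F] a ∈ envelope B :=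
  Submodule.subset_span ⟨i, g, hg, a, ha, rfl⟩

end Coordinates

/-- An algebra whose multiplication is that of a split extension, with the acting elements
satisfying a cyclic law, is a metabelian Malcev algebra. -/
theorem isMetabelianMalcev_of_coordinates {A : Type v} [NonUnitalNonAssocRing A] {R : Type*} [Ring R]
    (α m₁ m₂ : A →+ R) (hinj : ∀ s, α s = 0 → m₁ s = 0 → m₂ s = 0 → s = 0)
    (hα : ∀ s t, α (s * t) = 0) (h₁ : ∀ s t, m₁ (s * t) = m₂ s * α t - m₂ t * α s)
    (h₂ : ∀ s t, m₂ (s * t) = m₁ s * α t - m₁ t * α s)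
    (hcyc : ∀ a b c, α a * (α b * α c) = α b * (α c * α a)) : IsMetabelianMalcev A := by
  have hext : ∀ s t, α s = α t → m₁ s = m₁ t → m₂ s = m₂ t → s = t := by
    intro s t e e₁ e₂
    refine sub_eq_zero.1 (hinj _ ?_ ?_ ?_)
    · rw [map_sub, e, sub_self]
    · rw [map_sub, e₁, sub_self]
    · rw [map_sub, e₂, sub_self]
  refine ⟨fun a b => hext _ _ ?_ ?_ ?_, fun x y z => hext _ _ ?_ ?_ ?_,
    fun a b c d => hext _ _ ?_ ?_ ?_⟩
  · rw [map_neg, hα, hα, neg_zero]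
  · rw [map_neg, h₁, h₁, neg_sub]
  · rw [map_neg, h₂, h₂, neg_sub]
  · simp only [jacobian, map_add, hα, add_zero]
  -- Both sides are sums of a module coordinate times three acting coordinates; the cyclic law
  -- brings these triples to a common order.
  · simp only [jacobian, map_add, h₁, h₂, hα, mul_zero, sub_zero, zero_sub, zero_add, sub_mul,
      add_mul, mul_assoc, neg_mul, hcyc y z x, hcyc x z x, hcyc y x x]
    abel
  · simp only [jacobian, map_add, h₁, h₂, hα, mul_zero, sub_zero, zero_sub, zero_add, sub_mul,
      add_mul, mul_assoc, neg_mul, hcyc y z x, hcyc x z x, hcyc y x x]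
    abel
  · rw [map_zero, hα]
  · rw [map_zero, h₁, hα, hα, mul_zero, mul_zero, sub_zero]
  · rw [map_zero, h₂, hα, hα, mul_zero, mul_zero, sub_zero]

theorem zmod_two_cases (i : ZMod 2) : i = 0 ∨ i = 1 := by
  revert i
  decide

/-! ### A superalgebra with an even acting element -/

section LieModel

variable (F : Type u) [Field F]

/-- The algebra with basis `d = (1, 0)`, `s = (0, 1)` and products `s d = s = -d s`. -/
def LieModel : Type u := F × F

namespace LieModel

instance : AddCommGroup (LieModel F) := inferInstanceAs (AddCommGroup (F × F))
instance : Module F (LieModel F) := inferInstanceAs (Module F (F × F))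
instance : Mul (LieModel F) := ⟨fun a b => ((0 : F), a.2 * b.1 - a.1 * b.2)⟩

variable {F}

/-- The coordinate at `d`. -/
def α : LieModel F →ₗ[F] F := LinearMap.fst F F F
/-- The coordinate at `s`. -/
def m : LieModel F →ₗ[F] F := LinearMap.snd F F F

@[ext] theorem ext {a b : LieModel F} (h₁ : α a = α b) (h₂ : m a = m b) : a = b := Prod.ext h₁ h₂

@[simp] theorem α_mul (a b : LieModel F) : α (a * b) = 0 := rfl
@[simp] theorem m_mul (a b : LieModel F) : m (a * b) = m a * α b - α a * m b := rfl

instance : NonUnitalNonAssocRing (LieModel F) where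
  left_distrib a b c := by ext <;> simp; ring
  right_distrib a b c := by ext <;> simp; ring
  zero_mul a := by ext <;> simp
  mul_zero a := by ext <;> simp

instance : IsScalarTower F (LieModel F) (LieModel F) where
  smul_assoc c a b := by ext <;> simp [smul_eq_mul]; ring

instance : SMulCommClass F (LieModel F) (LieModel F) where
  smul_comm c a b := by ext <;> simp [smul_eq_mul]; ring

/-- The element `d`. -/
def d : LieModel F := ((1 : F), (0 : F))
/-- The element `s`. -/
def s : LieModel F := ((0 : F), (1 : F))

@[simp] theorem α_d : α (d : LieModel F) = 1 := rfl
@[simp] theorem m_d : m (d : LieModel F) = 0 := rfl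
@[simp] theorem α_s : α (s : LieModel F) = 0 := rfl
@[simp] theorem m_s : m (s : LieModel F) = 1 := rfl

theorem s_mul_d : (s * d : LieModel F) = s := by ext <;> simp
theorem d_mul_s : (d * s : LieModel F) = -s := by ext <;> simp
theorem d_mul_d : (d * d : LieModel F) = 0 := by ext <;> simp

variable (F) in
/-- `LieModel` as a superalgebra with `d` even and `s` odd. -/
def super : Superalgebra F where
  carrier := LieModel F
  part i := if i = 0 then LinearMap.ker m else LinearMap.ker α
  isCompl := by
    rw [if_pos rfl, if_neg one_ne_zero]
    constructor
    · rw [Submodule.disjoint_def]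
      intro a h₁ h₂
      exact ext h₂ h₁
    · rw [codisjoint_iff, eq_top_iff]
      intro a _
      refine Submodule.mem_sup.2 ⟨α a • d, ?_, m a • s, ?_, ?_⟩
      · simp
      · simp
      · ext <;> simp
  mul_mem i j a b ha hb := by
    rcases zmod_two_cases i with rfl | rfl <;> rcases zmod_two_cases j with rfl | rfl
    · simp_all
    · simp
    · simp
    · have h : (1 : ZMod 2) + 1 = 0 := by decide
      simp_all

theorem d_mem : (d : LieModel F) ∈ (super F).part 0 := m_d
theorem s_mem : (s : LieModel F) ∈ (super F).part 1 := α_s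

/-- The acting coordinate `α` takes even values, which are central, so the cyclic law is immediate.
One module coordinate plays both roles `m₁` and `m₂`. -/
theorem isMetabelianMalcev_envelope : IsMetabelianMalcev (envelope (super F)) := by
  let co (φ : LieModel F →ₗ[F] F) : envelope (super F) →+ Grassmann F :=
    ((coord φ).comp (envelopeSubmodule (super F)).subtype).toAddMonoidHom
  have hα : ∀ t : envelope (super F), co α t ∈ grassmannPart F 0 := fun t =>
    coord_mem (B := super F) α 0 (fun i hi a ha => by
      rcases zmod_two_cases i with rfl | rfl
      · exact absurd rfl hi
      · exact ha) t.2
  have hm : ∀ s t, co m (s * t) = co m s * co α t - co m t * co α s := by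
    intro s t
    have h := coord_mul (B := LieModel F) m m α α m (-1)
      (fun a b => by rw [m_mul]; ring) s.1 t.1
    rw [neg_one_smul, ← sub_eq_add_neg] at h
    exact h.trans (by rw [show coord α s.1 * coord m t.1 = coord m t.1 * coord α s.1 from
      even_central (hα s) _]; rfl)
  refine isMetabelianMalcev_of_coordinates (co α) (co m) (co m) ?_ ?_ hm hm ?_
  · intro t h₁ h₂ _
    have key : ∀ t : Grassmann F ⊗[F] LieModel F, t = coord α t ⊗ₜ d + coord m t ⊗ₜ s := by
      intro t
      induction t with
      | zero => simp
      | add t t' h h' =>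
        rw [map_add, map_add, TensorProduct.add_tmul, TensorProduct.add_tmul]
        nth_rw 1 [h, h']
        abel
      | tmul g a =>
        rw [coord_tmul, coord_tmul, TensorProduct.smul_tmul, TensorProduct.smul_tmul,
          ← TensorProduct.tmul_add]
        congr 1
        ext <;> simp
    refine Subtype.ext ((key t.1).trans ?_)
    rw [show coord α t.1 = 0 from h₁, show coord m t.1 = 0 from h₂, TensorProduct.zero_tmul,
      TensorProduct.zero_tmul, add_zero]
    rfl
  · intro s t
    exact coord_mul_eq_zero (B := LieModel F) α α_mul s.1 t.1
  · intro a b c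
    rw [even_central (hα a), mul_assoc]

end LieModel

end LieModel

/-! ### A superalgebra with an odd acting element -/

section SkewModel

variable (F : Type u) [Field F]

/-- The algebra with basis `d = (1, 0, 0)`, `s = (0, 1, 0)`, `t = (0, 0, 1)` and products
`s d = t = -d s`, `t d = s = d t`. -/
def SkewModel : Type u := F × F × F

namespace SkewModel

instance : AddCommGroup (SkewModel F) := inferInstanceAs (AddCommGroup (F × F × F))
instance : Module F (SkewModel F) := inferInstanceAs (Module F (F × F × F))
instance : Mul (SkewModel F) :=
  ⟨fun a b => ((0 : F), a.2.2 * b.1 + a.1 * b.2.2, a.2.1 * b.1 - a.1 * b.2.1)⟩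

variable {F}

/-- The coordinate at `d`. -/
def α : SkewModel F →ₗ[F] F := LinearMap.fst F F (F × F)
/-- The coordinate at `s`. -/
def m₀ : SkewModel F →ₗ[F] F := LinearMap.fst F F F ∘ₗ LinearMap.snd F F (F × F)
/-- The coordinate at `t`. -/
def m₁ : SkewModel F →ₗ[F] F := LinearMap.snd F F F ∘ₗ LinearMap.snd F F (F × F)

@[ext] theorem ext {a b : SkewModel F} (h : α a = α b) (h₀ : m₀ a = m₀ b) (h₁ : m₁ a = m₁ b) :
    a = b := Prod.ext h (Prod.ext h₀ h₁)

@[simp] theorem α_mul (a b : SkewModel F) : α (a * b) = 0 := rfl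
@[simp] theorem m₀_mul (a b : SkewModel F) : m₀ (a * b) = m₁ a * α b + α a * m₁ b := rfl
@[simp] theorem m₁_mul (a b : SkewModel F) : m₁ (a * b) = m₀ a * α b - α a * m₀ b := rfl

instance : NonUnitalNonAssocRing (SkewModel F) where
  left_distrib a b c := by ext <;> simp <;> ring
  right_distrib a b c := by ext <;> simp <;> ring
  zero_mul a := by ext <;> simp
  mul_zero a := by ext <;> simp

instance : IsScalarTower F (SkewModel F) (SkewModel F) where
  smul_assoc c a b := by ext <;> simp [smul_eq_mul] <;> ring

instance : SMulCommClass F (SkewModel F) (SkewModel F) where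
  smul_comm c a b := by ext <;> simp [smul_eq_mul] <;> ring

/-- The element `d`. -/
def d : SkewModel F := ((1 : F), (0 : F), (0 : F))
/-- The element `s`. -/
def s : SkewModel F := ((0 : F), (1 : F), (0 : F))
/-- The element `t`. -/
def t : SkewModel F := ((0 : F), (0 : F), (1 : F))

@[simp] theorem α_d : α (d : SkewModel F) = 1 := rfl
@[simp] theorem m₀_d : m₀ (d : SkewModel F) = 0 := rfl
@[simp] theorem m₁_d : m₁ (d : SkewModel F) = 0 := rfl
@[simp] theorem α_s : α (s : SkewModel F) = 0 := rfl
@[simp] theorem m₀_s : m₀ (s : SkewModel F) = 1 := rfl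
@[simp] theorem m₁_s : m₁ (s : SkewModel F) = 0 := rfl
@[simp] theorem α_t : α (t : SkewModel F) = 0 := rfl
@[simp] theorem m₀_t : m₀ (t : SkewModel F) = 0 := rfl
@[simp] theorem m₁_t : m₁ (t : SkewModel F) = 1 := rfl

theorem s_mul_d : (s * d : SkewModel F) = t := by ext <;> simp
theorem d_mul_s : (d * s : SkewModel F) = -t := by ext <;> simp
theorem d_mul_d : (d * d : SkewModel F) = 0 := by ext <;> simp

variable (F) in
/-- `SkewModel` as a superalgebra with `s` even and `d`, `t` odd. -/
def super : Superalgebra F where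
  carrier := SkewModel F
  part i := if i = 0 then LinearMap.ker α ⊓ LinearMap.ker m₁ else LinearMap.ker m₀
  isCompl := by
    rw [if_pos rfl, if_neg one_ne_zero]
    constructor
    · rw [Submodule.disjoint_def]
      intro a h₁ h₂
      exact ext h₁.1 h₂ h₁.2
    · rw [codisjoint_iff, eq_top_iff]
      intro a _
      refine Submodule.mem_sup.2 ⟨m₀ a • s, ?_, α a • d + m₁ a • t, ?_, ?_⟩
      · simp
      · simp
      · ext <;> simp
  mul_mem i j a b ha hb := by
    have h : (1 : ZMod 2) + 1 = 0 := by decide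
    rcases zmod_two_cases i with rfl | rfl <;> rcases zmod_two_cases j with rfl | rfl <;>
      simp_all

theorem d_mem : (d : SkewModel F) ∈ (super F).part 1 := m₀_d
theorem s_mem : (s : SkewModel F) ∈ (super F).part 0 := ⟨α_s, m₁_s⟩

/-- The values of `α` are odd, and moving one of them past two others costs two signs, so the cyclic
law holds although the values anticommute. The action interchanges the even coordinate `m₀` and the
odd coordinate `m₁`; the different signs in their product rules become equal on the envelope. -/
theorem isMetabelianMalcev_envelope : IsMetabelianMalcev (envelope (super F)) := by
  let co (φ : SkewModel F →ₗ[F] F) : envelope (super F) →+ Grassmann F :=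
    ((coord φ).comp (envelopeSubmodule (super F)).subtype).toAddMonoidHom
  have hα : ∀ t : envelope (super F), co α t ∈ grassmannPart F 1 := fun t =>
    coord_mem (B := super F) α 1 (fun i hi a ha => by
      rcases zmod_two_cases i with rfl | rfl
      · exact ha.1
      · exact absurd rfl hi) t.2
  have hm₀ : ∀ t : envelope (super F), co m₀ t ∈ grassmannPart F 0 := fun t =>
    coord_mem (B := super F) m₀ 0 (fun i hi a ha => by
      rcases zmod_two_cases i with rfl | rfl
      · exact absurd rfl hi
      · exact ha) t.2
  have hm₁ : ∀ t : envelope (super F), co m₁ t ∈ grassmannPart F 1 := fun t =>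
    coord_mem (B := super F) m₁ 1 (fun i hi a ha => by
      rcases zmod_two_cases i with rfl | rfl
      · exact ha.2
      · exact absurd rfl hi) t.2
  refine isMetabelianMalcev_of_coordinates (co α) (co m₀) (co m₁) ?_ ?_ ?_ ?_ ?_
  · intro x h₁ h₂ h₃
    have key : ∀ x : Grassmann F ⊗[F] SkewModel F,
        x = coord α x ⊗ₜ d + coord m₀ x ⊗ₜ s + coord m₁ x ⊗ₜ t := by
      intro x
      induction x with
      | zero => simp
      | add x x' h h' =>
        simp only [map_add, TensorProduct.add_tmul]
        nth_rw 1 [h, h']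
        abel
      | tmul g a =>
        simp only [coord_tmul, TensorProduct.smul_tmul]
        rw [← TensorProduct.tmul_add, ← TensorProduct.tmul_add]
        congr 1
        ext <;> simp
    refine Subtype.ext ((key x.1).trans ?_)
    rw [show coord α x.1 = 0 from h₁, show coord m₀ x.1 = 0 from h₂,
      show coord m₁ x.1 = 0 from h₃, TensorProduct.zero_tmul, TensorProduct.zero_tmul,
      TensorProduct.zero_tmul, add_zero, add_zero]
    rfl
  · intro x y
    exact coord_mul_eq_zero (B := SkewModel F) α α_mul x.1 y.1
  · intro x y
    have h := coord_mul (B := SkewModel F) m₀ m₁ α α m₁ 1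
      (fun a b => by rw [m₀_mul]; ring) x.1 y.1
    refine h.trans ?_
    rw [one_smul, show coord α x.1 * coord m₁ y.1 = -(coord m₁ y.1 * coord α x.1) from
      odd_anticommute (hα x) (hm₁ y), ← sub_eq_add_neg]
    rfl
  · intro x y
    have h := coord_mul (B := SkewModel F) m₁ m₀ α α m₀ (-1)
      (fun a b => by rw [m₁_mul]; ring) x.1 y.1
    refine h.trans ?_
    rw [neg_one_smul, ← sub_eq_add_neg,
      show coord α x.1 * coord m₀ y.1 = coord m₀ y.1 * coord α x.1 from
        (even_central (hm₀ y) _).symm]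
    rfl
  · intro a b c
    rw [← mul_assoc, odd_anticommute (hα a) (hα b), neg_mul, mul_assoc,
      odd_anticommute (hα a) (hα c), mul_neg, neg_neg]

end SkewModel

end SkewModel

/-! ### Homomorphisms of superalgebras -/

section Homomorphisms

variable {F : Type u} [Field F]

theorem map_lift {A : Type*} [NonUnitalNonAssocRing A] [Module F A] [IsScalarTower F A A]
    [SMulCommClass F A A] {B : Type*} [NonUnitalNonAssocRing B] [Module F B] [IsScalarTower F B B]
    [SMulCommClass F B B] {X : Type*} (φ : A →ₙₐ[F] B) (a : X → A)
    (f : FreeNonUnitalNonAssocAlgebra F X) :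
    φ (FreeNonUnitalNonAssocAlgebra.lift F a f)
      = FreeNonUnitalNonAssocAlgebra.lift F (fun x => φ (a x)) f := by
  have h : φ.comp (FreeNonUnitalNonAssocAlgebra.lift F a)
      = FreeNonUnitalNonAssocAlgebra.lift F (fun x => φ (a x)) := by
    refine FreeNonUnitalNonAssocAlgebra.hom_ext _ fun x => ?_
    rw [NonUnitalAlgHom.comp_apply, FreeNonUnitalNonAssocAlgebra.lift_of_apply,
      FreeNonUnitalNonAssocAlgebra.lift_of_apply]
  exact DFunLike.congr_fun h f

/-- The homomorphism `G ⊗ A → G ⊗ B` induced by a homomorphism `A → B`. -/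
def tensorHom {A : Type v} [NonUnitalNonAssocRing A] [Module F A] [IsScalarTower F A A]
    [SMulCommClass F A A] {B : Type v} [NonUnitalNonAssocRing B] [Module F B] [IsScalarTower F B B]
    [SMulCommClass F B B] (φ : A →ₙₐ[F] B) :
    Grassmann F ⊗[F] A →ₙₐ[F] Grassmann F ⊗[F] B where
  toFun := LinearMap.lTensor (Grassmann F) (φ : A →ₗ[F] B)
  map_smul' c x := map_smul _ c x
  map_zero' := map_zero _
  map_add' := map_add _
  map_mul' x y := by
    induction x with
    | zero => rw [zero_mul, map_zero, zero_mul]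
    | add x x' h h' => rw [add_mul, map_add, h, h', map_add, add_mul]
    | tmul g a =>
      induction y with
      | zero => rw [mul_zero, map_zero, mul_zero]
      | add y y' h h' => rw [mul_add, map_add, h, h', map_add, mul_add]
      | tmul g' b =>
        rw [Algebra.TensorProduct.tmul_mul_tmul, LinearMap.lTensor_tmul, LinearMap.lTensor_tmul,
          LinearMap.lTensor_tmul, Algebra.TensorProduct.tmul_mul_tmul]
        exact congrArg _ (map_mul φ a b)

theorem tensorHom_tmul {A : Type v} [NonUnitalNonAssocRing A] [Module F A] [IsScalarTower F A A]
    [SMulCommClass F A A] {B : Type v} [NonUnitalNonAssocRing B] [Module F B] [IsScalarTower F B B]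
    [SMulCommClass F B B] (φ : A →ₙₐ[F] B) (g : Grassmann F) (a : A) :
    tensorHom φ (g ⊗ₜ a) = g ⊗ₜ φ a := rfl

theorem tensorHom_mem_envelope {A B : Superalgebra F} (φ : A.carrier →ₙₐ[F] B.carrier)
    (hφ : ∀ i, ∀ a ∈ A.part i, φ a ∈ B.part i) {t : Grassmann F ⊗[F] A.carrier}
    (ht : t ∈ envelope A) : tensorHom φ t ∈ envelope B := by
  change t ∈ envelopeSubmodule A at ht
  unfold envelopeSubmodule at ht
  induction ht using Submodule.span_induction with
  | zero => rw [map_zero]; exact zero_mem _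
  | add p q _ _ hp hq => rw [map_add]; exact add_mem hp hq
  | smul c p _ hp => rw [map_smul]; exact SMulMemClass.smul_mem _ hp
  | mem p hp =>
    obtain ⟨i, g, hg, a, ha, rfl⟩ := hp
    exact tmul_mem_envelope hg (hφ i a ha)

theorem coe_lift_envelope {A : Superalgebra F} (a : ℕ → envelope A) (f : NAPoly F) :
    ((FreeNonUnitalNonAssocAlgebra.lift F a f : envelope A) : Grassmann F ⊗[F] A.carrier)
      = FreeNonUnitalNonAssocAlgebra.lift F (fun k => (a k : Grassmann F ⊗[F] A.carrier)) f :=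
  map_lift (NonUnitalSubalgebraClass.subtype (envelope A)) a f

/-- The map `G ⊗ M → M` induced by a linear functional on `G`. -/
def slice {M : Type v} [AddCommGroup M] [Module F M] (ψ : Grassmann F →ₗ[F] F) :
    Grassmann F ⊗[F] M →ₗ[F] M :=
  (TensorProduct.lid F M).toLinearMap ∘ₗ LinearMap.rTensor M ψ

theorem slice_tmul {M : Type v} [AddCommGroup M] [Module F M] (ψ : Grassmann F →ₗ[F] F)
    (g : Grassmann F) (m : M) : slice ψ (g ⊗ₜ[F] m) = ψ g • m := by
  simp [slice]

/-- The slices along the coordinate functionals of a basis of `G` are the coefficients of `t` with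
respect to that basis. -/
theorem eq_zero_of_slice {M : Type v} [AddCommGroup M] [Module F M] {t : Grassmann F ⊗[F] M}
    (h : ∀ ψ : Grassmann F →ₗ[F] F, slice ψ t = 0) : t = 0 := by
  classical
  let b := Module.Basis.ofVectorSpace F (Grassmann F)
  have key : ∀ i, ∀ t : Grassmann F ⊗[F] M,
      TensorProduct.equivFinsuppOfBasisLeft b t i = slice (b.coord i) t := by
    intro i t
    induction t with
    | zero => simp
    | add x y hx hy => rw [map_add, map_add, Finsupp.add_apply, hx, hy]
    | tmul g m =>
      rw [TensorProduct.equivFinsuppOfBasisLeft_apply_tmul_apply, slice_tmul,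
        Module.Basis.coord_apply]
  apply (TensorProduct.equivFinsuppOfBasisLeft b).injective
  rw [map_zero]
  ext i
  rw [key, h, Finsupp.zero_apply]

theorem slice_tensorHom {A : Type v} [NonUnitalNonAssocRing A] [Module F A] [IsScalarTower F A A]
    [SMulCommClass F A A] {B : Type v} [NonUnitalNonAssocRing B] [Module F B] [IsScalarTower F B B]
    [SMulCommClass F B B] (φ : A →ₙₐ[F] B) (ψ : Grassmann F →ₗ[F] F)
    (t : Grassmann F ⊗[F] A) : slice ψ (tensorHom φ t) = φ (slice ψ t) := by
  induction t with
  | zero => simp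
  | add x y hx hy => rw [map_add, map_add, map_add, map_add, hx, hy]
  | tmul g a => rw [tensorHom_tmul, slice_tmul, slice_tmul, map_smul]

end Homomorphisms

/-! ### The free superalgebra -/

section Free

variable {F : Type u} [Field F] {S : Set (NAPoly F)} {r s : ℕ}

/-- Evaluation of the elements of the free `V`-superalgebra in a `V`-superalgebra. -/
def evalFree {B : Superalgebra F} (hB : B ∈ superalgebrasOf S) (b : Fin r ⊕ Fin s → B.carrier)
    (hb : ∀ z, b z ∈ B.part (genParity z)) : FreeCarrier S r s →ₙₐ[F] B.carrier where
  toFun := Quotient.lift (fun p => FreeNonUnitalNonAssocAlgebra.lift F b p)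
    fun _ _ h => h B hB b hb
  map_smul' c := by
    rintro ⟨p⟩
    exact map_smul (FreeNonUnitalNonAssocAlgebra.lift F b) c p
  map_zero' := map_zero (FreeNonUnitalNonAssocAlgebra.lift F b)
  map_add' := by
    rintro ⟨p⟩ ⟨q⟩
    exact map_add (FreeNonUnitalNonAssocAlgebra.lift F b) p q
  map_mul' := by
    rintro ⟨p⟩ ⟨q⟩
    exact map_mul (FreeNonUnitalNonAssocAlgebra.lift F b) p q

theorem evalFree_mk {B : Superalgebra F} (hB : B ∈ superalgebrasOf S)
    (b : Fin r ⊕ Fin s → B.carrier) (hb : ∀ z, b z ∈ B.part (genParity z)) (p : FreeNA F r s) :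
    evalFree hB b hb (freeMk S r s p) = FreeNonUnitalNonAssocAlgebra.lift F b p := rfl

theorem evalFree_mem {B : Superalgebra F} (hB : B ∈ superalgebrasOf S)
    (b : Fin r ⊕ Fin s → B.carrier) (hb : ∀ z, b z ∈ B.part (genParity z)) (i : ZMod 2)
    (x : FreeCarrier S r s) (hx : x ∈ (freeSuperalgebra S r s).part i) :
    evalFree hB b hb x ∈ B.part i := by
  obtain ⟨p, hp, rfl⟩ := hx
  exact lift_mem_part B b hb i p hp

theorem free_eq_zero {x : FreeCarrier S r s}
    (h : ∀ (B : Superalgebra F) (hB : B ∈ superalgebrasOf S) (b : Fin r ⊕ Fin s → B.carrier)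
      (hb : ∀ z, b z ∈ B.part (genParity z)), evalFree hB b hb x = 0) : x = 0 := by
  induction x using Quotient.inductionOn with
  | h p =>
    refine (RingCon.eq (freeCon S r s)).2 fun B hB b hb => ?_
    rw [map_zero]
    exact h B hB b hb

/-- Functionals on `G` separate the tensors, and evaluations in superalgebras of the variety
separate the points of the free superalgebra by its construction. Each such evaluation carries the
envelope into one where the identity is known. -/
theorem freeSuperalgebra_mem (S : Set (NAPoly F)) (r s : ℕ) :
    freeSuperalgebra S r s ∈ superalgebrasOf S := by
  intro f hf a
  refine Subtype.ext ?_
  rw [coe_lift_envelope]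
  refine eq_zero_of_slice fun ψ => ?_
  refine free_eq_zero fun B hB b hb => ?_
  have hmem : ∀ k, tensorHom (evalFree hB b hb) (a k).1 ∈ envelope B := fun k =>
    tensorHom_mem_envelope (A := freeSuperalgebra S r s) (evalFree hB b hb)
      (evalFree_mem hB b hb) (a k).2
  have h := congrArg Subtype.val (hB f hf fun k => ⟨_, hmem k⟩)
  rw [coe_lift_envelope] at h
  have h2 := map_lift (tensorHom (evalFree hB b hb))
    (fun k => ((a k).1 : Grassmann F ⊗[F] FreeCarrier S r s)) f
  refine (slice_tensorHom (evalFree hB b hb) ψ _).symm.trans ?_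
  refine (congrArg (slice ψ) (h2.trans h)).trans ?_
  exact map_zero _

/-- The class of the generator `z`. -/
def freeGen (S : Set (NAPoly F)) (z : Fin r ⊕ Fin s) : FreeCarrier S r s :=
  freeMk S r s (FreeNonUnitalNonAssocAlgebra.of F z)

theorem freeGen_mem (S : Set (NAPoly F)) (z : Fin r ⊕ Fin s) :
    freeGen S z ∈ (freeSuperalgebra S r s).part (genParity z) :=
  ⟨_, Submodule.subset_span ⟨FreeMagma.of z, rfl, rfl⟩, rfl⟩

/-- A superidentity of the free superalgebra vanishes under the substitutions of multiples of
homogeneous elements for the variables. -/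
theorem lift_eq_zero_of_free {f : NAPoly F}
    (hf : SatisfiesSuperidentity f (freeSuperalgebra S r s)) {B : Superalgebra F}
    (hB : B ∈ superalgebrasOf S) (b : Fin r ⊕ Fin s → B.carrier)
    (hb : ∀ z, b z ∈ B.part (genParity z)) (x : ℕ → Grassmann F ⊗[F] B.carrier)
    (hx : ∀ k, ∃ z, ∃ g ∈ grassmannPart F (genParity z), x k = g ⊗ₜ b z) :
    FreeNonUnitalNonAssocAlgebra.lift F x f = 0 := by
  choose z g hg hx using hx
  obtain rfl : x = fun k => g k ⊗ₜ b (z k) := funext hx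
  have h := congrArg Subtype.val (hf fun k =>
    ⟨g k ⊗ₜ freeGen S (z k), tmul_mem_envelope (hg k) (freeGen_mem S (z k))⟩)
  rw [coe_lift_envelope] at h
  have h2 := map_lift (tensorHom (evalFree hB b hb))
    (fun k => (g k ⊗ₜ freeGen S (z k) : Grassmann F ⊗[F] FreeCarrier S r s)) f
  have h3 := (congrArg (tensorHom (evalFree hB b hb)) h).symm.trans h2
  have h4 : (fun k => tensorHom (evalFree hB b hb)
      (g k ⊗ₜ freeGen S (z k) : Grassmann F ⊗[F] FreeCarrier S r s)) = fun k => g k ⊗ₜ b (z k) := by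
    funext k
    rw [tensorHom_tmul, freeGen, evalFree_mk, FreeNonUnitalNonAssocAlgebra.lift_of_apply]
  rw [h4] at h3
  rw [← h3]
  exact map_zero _

end Free

/-! ### Multilinear polynomials -/

section Multilinear

variable {F : Type u} [Field F]

/-- A nonassociative word as a polynomial. -/
def wordPoly (F : Type u) [Field F] (w : FreeMagma ℕ) : NAPoly F := MonoidAlgebra.ofMagma F _ w

theorem wordPoly_of (i : ℕ) : wordPoly F (.of i) = var F i := rfl

theorem wordPoly_mul (w w' : FreeMagma ℕ) :
    wordPoly F (w * w') = wordPoly F w * wordPoly F w' := map_mul _ _ _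

/-- The polynomials multilinear of degree `n`, in the variables `x 0, …, x (n - 1)`. -/
def IsMultilinearOfDegree (n : ℕ) (f : NAPoly F) : Prop :=
  ∀ w ∈ f.coeff.support, ∀ i : ℕ, occ i w = if i < n then 1 else 0

theorem IsMultilinearOfDegree.add {n : ℕ} {f g : NAPoly F} (hf : IsMultilinearOfDegree n f)
    (hg : IsMultilinearOfDegree n g) : IsMultilinearOfDegree n (f + g) := by
  classical
  intro w hw
  rw [MonoidAlgebra.coeff_add] at hw
  exact (Finset.mem_union.1 (Finsupp.support_add hw)).elim (hf w) (hg w)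

theorem IsMultilinearOfDegree.sub {n : ℕ} {f g : NAPoly F} (hf : IsMultilinearOfDegree n f)
    (hg : IsMultilinearOfDegree n g) : IsMultilinearOfDegree n (f - g) := by
  classical
  intro w hw
  rw [MonoidAlgebra.coeff_sub] at hw
  exact (Finset.mem_union.1 (Finsupp.support_sub hw)).elim (hf w) (hg w)

theorem isMultilinearOfDegree_wordPoly {n : ℕ} {w : FreeMagma ℕ}
    (h : ∀ i : ℕ, occ i w = if i < n then 1 else 0) :
    IsMultilinearOfDegree n (wordPoly F w) := by
  intro w' hw'
  have : w' ∈ (Finsupp.single w (1 : F)).support := hw'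
  rw [Finset.mem_singleton.1 (Finsupp.support_single_subset this)]
  exact h

/-- The linearization of the Malcev identity. -/
def malcevLinearization (F : Type u) [Field F] : NAPoly F :=
  jacobian (var F 0) (var F 1) (var F 2) * var F 3
    + jacobian (var F 3) (var F 1) (var F 2) * var F 0
    - jacobian (var F 0) (var F 1) (var F 3 * var F 2)
    - jacobian (var F 3) (var F 1) (var F 0 * var F 2)

theorem isMultilinear_malcevLinearization : IsMultilinear (malcevLinearization F) := by
  refine ⟨4, ?_⟩
  change IsMultilinearOfDegree 4 _
  unfold malcevLinearization jacobian
  simp only [add_mul, ← wordPoly_of, ← wordPoly_mul]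
  -- `occ` unfolds along the bracketing, so the three shapes `((ab)c)d`, `(ab)(cd)` and `(a(bc))d`
  -- in the expansion are treated separately.
  have hocc : ∀ a b c d : ℕ, [a, b, c, d].Perm [0, 1, 2, 3] → ∀ i : ℕ,
      ((occ i (.of a) + occ i (.of b)) + occ i (.of c)) + occ i (.of d) = if i < 4 then 1 else 0 := by
    intro a b c d h i
    have hc := h.count_eq i
    simp only [List.count_cons, List.count_nil, beq_iff_eq] at hc
    simp only [occ]
    split_ifs at hc ⊢ <;> omega
  have hocc' : ∀ a b c d : ℕ, [a, b, c, d].Perm [0, 1, 2, 3] → ∀ i : ℕ,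
      (occ i (.of a) + occ i (.of b)) + (occ i (.of c) + occ i (.of d))
        = if i < 4 then 1 else 0 := by
    intro a b c d h i
    rw [← hocc a b c d h i]
    omega
  have hocc'' : ∀ a b c d : ℕ, [a, b, c, d].Perm [0, 1, 2, 3] → ∀ i : ℕ,
      (occ i (.of a) + (occ i (.of b) + occ i (.of c))) + occ i (.of d)
        = if i < 4 then 1 else 0 := by
    intro a b c d h i
    rw [← hocc a b c d h i]
    omega
  refine .sub (.sub (.add (.add (.add ?_ ?_) ?_) (.add (.add ?_ ?_) ?_)) (.add (.add ?_ ?_) ?_))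
    (.add (.add ?_ ?_) ?_) <;> apply isMultilinearOfDegree_wordPoly
  all_goals first
    | exact hocc _ _ _ _ (by decide)
    | exact hocc' _ _ _ _ (by decide)
    | exact hocc'' _ _ _ _ (by decide)

theorem satisfiesIdentity_malcevLinearization {A : Type v} [NonUnitalNonAssocRing A]
    [Module F A] [IsScalarTower F A A] [SMulCommClass F A A] (hA : IsMetabelianMalcev A) :
    SatisfiesIdentity (malcevLinearization F) A := by
  intro a
  have h1 := hA.malcev (a 0 + a 3) (a 1) (a 2)
  have h2 := hA.malcev (a 0) (a 1) (a 2)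
  have h3 := hA.malcev (a 3) (a 1) (a 2)
  simp only [malcevLinearization, jacobian, map_add, map_sub, map_mul, lift_var]
  simp only [jacobian, add_mul, mul_add] at h1 h2 h3 ⊢
  refine Eq.trans ?_ (sub_eq_zero.2 (congrArg₂ (· - ·) h1 (congrArg₂ (· + ·) h2 h3)))
  abel

theorem satisfiesIdentity_malcev [CharZero F] {A : Type v} [NonUnitalNonAssocRing A]
    [Module F A] [IsScalarTower F A A] [SMulCommClass F A A]
    (hA : SatisfiesIdentity (malcevLinearization F) A) :
    SatisfiesIdentity (jacobian (var F 0) (var F 1) (var F 2) * var F 0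
      - jacobian (var F 0) (var F 1) (var F 0 * var F 2)) A := by
  intro a
  -- Identifying the variable `3` with the variable `0` gives twice the Malcev identity.
  have h := hA fun i => if i = 3 then a 0 else a i
  simp only [malcevLinearization, jacobian, map_add, map_sub, map_mul, lift_var, if_true,
    OfNat.zero_ne_ofNat, OfNat.one_ne_ofNat, Nat.reduceEqDiff, if_false] at h
  simp only [jacobian, map_sub, map_add, map_mul, lift_var]
  have h2 : (2 : F) • (jacobian (a 0) (a 1) (a 2) * a 0 - jacobian (a 0) (a 1) (a 0 * a 2)) = 0 := by
    refine Eq.trans ?_ h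
    simp only [jacobian]
    module
  exact (smul_eq_zero.1 h2).resolve_left two_ne_zero

theorem isMultilinear_anticomm : IsMultilinear (var F 0 * var F 1 + var F 1 * var F 0) := by
  refine ⟨2, ?_⟩
  change IsMultilinearOfDegree 2 _
  simp only [← wordPoly_of, ← wordPoly_mul]
  refine .add ?_ ?_ <;> apply isMultilinearOfDegree_wordPoly <;> intro i <;>
    change occ i (.of _) + occ i (.of _) = _ <;> simp only [occ] <;> split_ifs <;> omega

theorem isMultilinear_metabelian :
    IsMultilinear ((var F 0 * var F 1) * (var F 2 * var F 3)) := by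
  refine ⟨4, ?_⟩
  change IsMultilinearOfDegree 4 _
  simp only [← wordPoly_of, ← wordPoly_mul]
  apply isMultilinearOfDegree_wordPoly
  intro i
  change (occ i (.of _) + occ i (.of _)) + (occ i (.of _) + occ i (.of _)) = _
  simp only [occ]
  split_ifs <;> omega

theorem mem_superalgebrasOf_iff {B : Superalgebra F} :
    B ∈ superalgebrasOf (malcev F ∪ metabelian F) ↔ IsMetabelianMalcev (envelope B) :=
  inVariety_iff

/-- The free superalgebra belongs to the variety, and the defining identities are multilinear except
the Malcev identity, which is equivalent to its linearization in characteristic zero. -/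
theorem superrankVariety_subset [CharZero F] (r s : ℕ) :
    superrankVariety (malcev F ∪ metabelian F) r s ⊆ superalgebrasOf (malcev F ∪ metabelian F) := by
  intro B hB
  have hfree := freeSuperalgebra_mem (malcev F ∪ metabelian F) r s
  have h1 := hB _ isMultilinear_anticomm (hfree _ (Or.inl (Or.inl rfl)))
  have h2 := hB _ isMultilinear_malcevLinearization
    (satisfiesIdentity_malcevLinearization (mem_superalgebrasOf_iff.1 hfree))
  have h3 := hB _ isMultilinear_metabelian (hfree _ (Or.inr rfl))
  rintro f ((rfl | rfl) | rfl)
  · exact h1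
  · exact satisfiesIdentity_malcev h2
  · exact h3

end Multilinear

/-! ### Normal form of nonassociative words -/

/-- The list of the variables of a word. -/
def leaves : FreeMagma ℕ → List ℕ
  | .of i => [i]
  | .mul u w => leaves u ++ leaves w

theorem leaves_ne_nil (w : FreeMagma ℕ) : leaves w ≠ [] := by
  induction w with
  | ih1 i => exact List.cons_ne_nil _ _
  | ih2 u w hu _ => exact fun h => hu (List.append_eq_nil_iff.1 h).1

theorem occ_eq_count (i : ℕ) (w : FreeMagma ℕ) : occ i w = (leaves w).count i := by
  induction w with
  | ih1 j =>
    change (if j = i then 1 else 0) = List.count i [j]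
    rw [List.count_singleton]
    simp
  | ih2 u w hu hw =>
    change occ i u + occ i w = (leaves u ++ leaves w).count i
    rw [hu, hw, List.count_append]

theorem leaves_perm_range {n : ℕ} {w : FreeMagma ℕ}
    (h : ∀ i : ℕ, occ i w = if i < n then 1 else 0) : (leaves w).Perm (List.range n) := by
  rw [List.perm_iff_count]
  intro i
  rw [← occ_eq_count, h i, List.nodup_range.count]
  simp

/-- A product of two words of length at least two is zero; otherwise one factor is a letter, which
anticommutativity moves to the right end. The data are chosen before the algebra, so one normal form
serves the two models and an arbitrary envelope together. -/
theorem exists_normalForm (w : FreeMagma ℕ) : ∃ (c : ℤ) (i j : ℕ) (l : List ℕ),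
    2 ≤ (leaves w).length → (i :: j :: l).Perm (leaves w) ∧
      ∀ (A : Type v) [NonUnitalNonAssocRing A], IsMetabelianMalcev A → ∀ a : ℕ → A,
        FreeMagma.lift a w = c • leftNormed (a i * a j) (l.map a) := by
  induction w with
  | ih1 i => exact ⟨0, 0, 0, [], fun h => absurd h (by simp [leaves])⟩
  | ih2 u w hu hw =>
    obtain ⟨c, i, j, l, h⟩ := hu
    obtain ⟨c', i', j', l', h'⟩ := hw
    have hpos : ∀ w : FreeMagma ℕ, 1 ≤ (leaves w).length := fun w =>
      List.length_pos_iff.2 (leaves_ne_nil w)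
    by_cases hu2 : 2 ≤ (leaves u).length
    · obtain ⟨hp, he⟩ := h hu2
      by_cases hw2 : 2 ≤ (leaves w).length
      · obtain ⟨hp', he'⟩ := h' hw2
        -- The coefficient is zero, so the order of the list is irrelevant; it only has to contain
        -- the right letters.
        refine ⟨0, i, j, l ++ leaves w, fun _ => ⟨hp.append_right (leaves w), ?_⟩⟩
        intro A _ hA a
        rw [map_mul, he A hA, he' A hA, zero_smul, smul_mul_smul_comm]
        have hprod : ∀ (l : List A) (p q : A), ∃ p' q', leftNormed (p * q) l = p' * q' := by
          intro l
          induction l with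
          | nil => exact fun p q => ⟨p, q, rfl⟩
          | cons x l ih => exact fun p q => ih (p * q) x
        obtain ⟨p, q, e⟩ := hprod (l.map a) (a i) (a j)
        obtain ⟨p', q', e'⟩ := hprod (l'.map a) (a i') (a j')
        rw [e, e', hA.metabelian, smul_zero]
      · match w, hw2 with
        | .of k, _ =>
          refine ⟨c, i, j, l ++ [k], fun _ => ⟨hp.append_right [k], ?_⟩⟩
          intro A _ hA a
          change FreeMagma.lift a u * a k = _
          rw [he A hA, List.map_append, leftNormed_append, smul_mul_assoc]
          rfl
        | .mul w₁ w₂, hw2 =>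
          refine absurd ?_ hw2
          change 2 ≤ (leaves w₁ ++ leaves w₂).length
          rw [List.length_append]
          exact add_le_add (hpos w₁) (hpos w₂)
    · match u, hu2 with
      | .of k, _ =>
        by_cases hw2 : 2 ≤ (leaves w).length
        · obtain ⟨hp', he'⟩ := h' hw2
          refine ⟨-c', i', j', l' ++ [k],
            fun _ => ⟨(List.perm_append_singleton k (i' :: j' :: l')).trans (hp'.cons k), ?_⟩⟩
          intro A _ hA a
          change a k * FreeMagma.lift a w = _
          rw [hA.anticomm, he' A hA, List.map_append, leftNormed_append, smul_mul_assoc, neg_smul]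
          rfl
        · match w, hw2 with
          | .of m, _ =>
            refine ⟨1, k, m, [], fun _ => ⟨List.Perm.refl _, ?_⟩⟩
            intro A _ hA a
            rw [one_smul]
            rfl
          | .mul w₁ w₂, hw2 =>
            refine absurd ?_ hw2
            change 2 ≤ (leaves w₁ ++ leaves w₂).length
            rw [List.length_append]
            exact add_le_add (hpos w₁) (hpos w₂)
      | .mul w₁ w₂, hu2 =>
        refine absurd ?_ hu2
        change 2 ≤ (leaves w₁ ++ leaves w₂).length
        rw [List.length_append]
        exact add_le_add (hpos w₁) (hpos w₂)

/-! ### Values of polynomials and left-normed products at the test points of the models -/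

section Evaluation

variable {F : Type u} [Field F]

theorem lift_wordPoly {A : Type v} [NonUnitalNonAssocRing A] [Module F A] [IsScalarTower F A A]
    [SMulCommClass F A A] (a : ℕ → A) (w : FreeMagma ℕ) :
    FreeNonUnitalNonAssocAlgebra.lift F a (wordPoly F w) = FreeMagma.lift a w := by
  induction w with
  | ih1 i => exact lift_var a i
  | ih2 u w hu hw => rw [wordPoly_mul, map_mul, map_mul, hu, hw]

theorem lift_eq_sum {A : Type v} [NonUnitalNonAssocRing A] [Module F A] [IsScalarTower F A A]
    [SMulCommClass F A A] (a : ℕ → A) (f : NAPoly F) :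
    FreeNonUnitalNonAssocAlgebra.lift F a f
      = ∑ w ∈ f.coeff.support, f.coeff w • FreeMagma.lift a w := by
  conv_lhs => rw [← MonoidAlgebra.sum_coeff_single f]
  rw [Finsupp.sum, map_sum]
  refine Finset.sum_congr rfl fun w _ => ?_
  have h : MonoidAlgebra.single w (f.coeff w) = f.coeff w • wordPoly F w := by
    rw [wordPoly, MonoidAlgebra.ofMagma_apply, MonoidAlgebra.smul_single, smul_eq_mul, mul_one]
  rw [h, map_smul, lift_wordPoly]

theorem coe_leftNormed {B : Superalgebra F} (w : envelope B) (l : List (envelope B)) :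
    ((leftNormed w l : envelope B) : Grassmann F ⊗[F] B.carrier)
      = leftNormed w.1 (l.map Subtype.val) := by
  induction l generalizing w with
  | nil => rfl
  | cons x l ih => exact ih (w * x)

theorem listSign_smul_prod_gen {l l' : List ℕ} (h : l.Perm l') (hl : l.Nodup) :
    listSign l • (l.map (gen F)).prod = listSign l' • (l'.map (gen F)).prod := by
  induction h with
  | nil => rfl
  | @cons x l l' h ih =>
    rw [List.map_cons, List.map_cons, List.prod_cons, List.prod_cons, listSign, listSign, mul_smul,
      mul_smul, ← mul_smul_comm (listSign l), ih (List.nodup_cons.1 hl).2, mul_smul_comm,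
      (h.map (pairSign x)).prod_eq]
  | swap x y l =>
    have hxy : x ≠ y := by
      rintro rfl
      simp at hl
    rw [listSign_swap hxy, neg_smul, ← smul_neg]
    simp only [List.map_cons, List.prod_cons]
    rw [← mul_assoc, gen_swap, neg_mul, neg_neg, mul_assoc]
  | trans h1 _ ih1 ih2 => rw [ih1 hl, ih2 (h1.nodup_iff.1 hl)]

namespace LieModel

/-- The substitution of an odd multiple of `s` for the variable `k` and of `d` for the others. -/
def point (F : Type u) [Field F] (k i : ℕ) : Grassmann F ⊗[F] LieModel F :=
  if i = k then gen F 0 ⊗ₜ s else 1 ⊗ₜ d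

theorem leftNormed_s {k : ℕ} {l : List ℕ} (h : k ∉ l) (g : Grassmann F) :
    leftNormed (g ⊗ₜ s) (l.map (point F k)) = g ⊗ₜ[F] (s : LieModel F) := by
  induction l with
  | nil => rfl
  | cons i l ih =>
    rw [List.mem_cons, not_or] at h
    rw [List.map_cons, leftNormed_cons, point, if_neg (Ne.symm h.1),
      Algebra.TensorProduct.tmul_mul_tmul, mul_one, s_mul_d, ih h.2]

/-- Since `d * d = 0`, the single factor `s` must be among the first two, and afterwards `d` acts on
`s` as the identity. The scalar is the coefficient of `p k` in `p i - p j`. -/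
theorem leftNormed_point {k i j : ℕ} {l : List ℕ} (h : (i :: j :: l).Nodup) :
    leftNormed (point F k i * point F k j) (l.map (point F k))
      = ((if i = k then 1 else 0) - (if j = k then 1 else 0) : F) •
        (gen F 0 ⊗ₜ[F] (s : LieModel F)) := by
  simp only [List.nodup_cons, List.mem_cons, not_or] at h
  obtain ⟨⟨hij, hil⟩, hjl, -⟩ := h
  by_cases hi : i = k
  · subst hi
    rw [if_pos rfl, if_neg (Ne.symm hij), sub_zero, one_smul]
    nth_rw 1 [point]
    nth_rw 1 [point]
    rw [if_pos rfl, if_neg (Ne.symm hij), Algebra.TensorProduct.tmul_mul_tmul, mul_one, s_mul_d,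
      leftNormed_s hil]
  · by_cases hj : j = k
    · subst hj
      rw [if_pos rfl, if_neg hi, zero_sub]
      refine Eq.trans ?_ (neg_one_smul F (gen F 0 ⊗ₜ[F] (s : LieModel F))).symm
      nth_rw 1 [point]
      nth_rw 1 [point]
      rw [if_pos rfl, if_neg hi, Algebra.TensorProduct.tmul_mul_tmul, one_mul, d_mul_s,
        TensorProduct.tmul_neg, leftNormed_neg, leftNormed_s hjl]
    · rw [if_neg hi, if_neg hj, sub_zero, zero_smul]
      nth_rw 1 [point]
      nth_rw 1 [point]
      rw [if_neg hi, if_neg hj, Algebra.TensorProduct.tmul_mul_tmul, d_mul_d, TensorProduct.tmul_zero,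
        leftNormed_zero]

theorem gen_tmul_s_ne_zero : gen F 0 ⊗ₜ[F] (s : LieModel F) ≠ 0 := by
  intro h
  have h' := congrArg (coord m) h
  rw [coord_tmul, map_zero, m_s, one_smul] at h'
  exact prod_gen_ne_zero (F := F) (l := [0]) (List.nodup_singleton 0) (by simpa using h')

end LieModel

namespace SkewModel

/-- The substitution of `s` for the variable `k` and of odd multiples of `d` for the others. -/
def point (F : Type u) [Field F] (k i : ℕ) : Grassmann F ⊗[F] SkewModel F :=
  if i = k then 1 ⊗ₜ s else gen F i ⊗ₜ d

theorem leftNormed_tmul {k : ℕ} {l : List ℕ} (h : k ∉ l) (g : Grassmann F) (b : SkewModel F) :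
    leftNormed (g ⊗ₜ b) (l.map (point F k))
      = (g * (l.map (gen F)).prod) ⊗ₜ[F] ((· * d)^[l.length] b) := by
  induction l generalizing g b with
  | nil => simp
  | cons i l ih =>
    rw [List.mem_cons, not_or] at h
    rw [List.map_cons, leftNormed_cons, point, if_neg (Ne.symm h.1),
      Algebra.TensorProduct.tmul_mul_tmul, ih h.2, List.map_cons, List.prod_cons, mul_assoc]
    rfl

/-- The common value, up to sign, of the left-normed products at `point F k`. -/
def value (F : Type u) [Field F] (n k : ℕ) : Grassmann F ⊗[F] SkewModel F :=
  (listSign (k :: (List.range n).erase k) • (((List.range n).erase k).map (gen F)).prod) ⊗ₜ[F]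
    ((· * d)^[n - 1] s)

/-- The component in `SkewModel` depends only on the number of factors `d`, and reordering the
Grassmann generators produces exactly the sign of the list. -/
theorem leftNormed_point_first {n k j : ℕ} {l : List ℕ} (h : (k :: j :: l).Perm (List.range n)) :
    leftNormed (point F k k * point F k j) (l.map (point F k))
      = listSign (k :: j :: l) • value F n k := by
  have hnodup : (k :: j :: l).Nodup := h.nodup_iff.2 List.nodup_range
  have hk : k ∉ j :: l := (List.nodup_cons.1 hnodup).1
  have h1 : leftNormed (point F k k * point F k j) (l.map (point F k))
      = leftNormed (1 ⊗ₜ s) ((j :: l).map (point F k)) := by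
    rw [List.map_cons, leftNormed_cons]
    nth_rw 1 [point]
    rw [if_pos rfl]
  have hperm : (j :: l).Perm ((List.range n).erase k) := by
    have := h.erase k
    rwa [List.erase_cons_head] at this
  have hlen : (j :: l).length = n - 1 := by
    have := h.length_eq
    rw [List.length_range] at this
    rw [← this]
    rfl
  have h2 : listSign (k :: j :: l) • ((j :: l).map (gen F)).prod
      = listSign (k :: (List.range n).erase k) • (((List.range n).erase k).map (gen F)).prod := by
    rw [listSign, listSign.eq_2 k ((List.range n).erase k), mul_smul, mul_smul,
      listSign_smul_prod_gen hperm (List.nodup_cons.1 hnodup).2,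
      (hperm.map (pairSign k)).prod_eq]
  rw [h1, leftNormed_tmul hk, one_mul, value, ← h2, hlen]
  simp only [← Int.cast_smul_eq_zsmul F]
  rw [TensorProduct.smul_tmul', smul_smul, ← Int.cast_mul, listSign_mul_self, Int.cast_one, one_smul]

/-- The scalar is the coefficient of `v k` in the alternating part. Interchanging the first two
factors changes both the product and `listSign`, which is why the indicators are added here. -/
theorem leftNormed_point {n k i j : ℕ} {l : List ℕ} (h : (i :: j :: l).Perm (List.range n)) :
    leftNormed (point F k i * point F k j) (l.map (point F k))
      = ((listSign (i :: j :: l) : F) * ((if i = k then 1 else 0) + (if j = k then 1 else 0))) •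
        value F n k := by
  have hij : i ≠ j := by
    rintro rfl
    simpa using h.nodup_iff.2 List.nodup_range
  by_cases hi : i = k
  · subst hi
    rw [if_pos rfl, if_neg (Ne.symm hij), add_zero, mul_one, leftNormed_point_first h]
    exact (Int.cast_smul_eq_zsmul F _ _).symm
  · by_cases hj : j = k
    · subst hj
      rw [if_pos rfl, if_neg hi, zero_add, mul_one]
      refine Eq.trans ?_ (Int.cast_smul_eq_zsmul F (listSign (i :: j :: l)) (value F n j)).symm
      rw [listSign_swap (Ne.symm hij), neg_smul, ← leftNormed_point_first ((List.Perm.swap i j l).trans h), ← leftNormed_neg]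
      congr 1
      simp only [point, if_pos, if_neg hi, Algebra.TensorProduct.tmul_mul_tmul, one_mul, mul_one,
        d_mul_s, s_mul_d, TensorProduct.tmul_neg]
    · rw [if_neg hi, if_neg hj, add_zero, mul_zero, zero_smul]
      nth_rw 1 [point]
      nth_rw 1 [point]
      rw [if_neg hi, if_neg hj, Algebra.TensorProduct.tmul_mul_tmul, d_mul_d, TensorProduct.tmul_zero,
        leftNormed_zero]

/-- Right multiplication by `d` interchanges `s` and `t`, so the functional `m₀ + m₁` is invariant
and no distinction by the parity of `n` is needed. -/
theorem coord_iterate (g : Grassmann F) (b : SkewModel F) (n : ℕ) :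
    coord (m₀ + m₁) (g ⊗ₜ[F] ((· * d)^[n] b)) = coord (m₀ + m₁) (g ⊗ₜ[F] b) := by
  induction n generalizing b with
  | zero => rfl
  | succ n ih =>
    rw [Function.iterate_succ_apply, ih, coord_tmul, coord_tmul]
    congr 1
    simp [add_comm]

theorem value_ne_zero (n k : ℕ) : value F n k ≠ 0 := by
  intro h
  have h' := congrArg (coord (m₀ + m₁)) h
  rw [value, coord_iterate, coord_tmul, map_zero, LinearMap.add_apply, m₀_s, m₁_s, add_zero,
    one_smul] at h'
  have h'' := congrArg (listSign (k :: (List.range n).erase k) • ·) h'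
  simp only [smul_listSign_smul, smul_zero] at h''
  exact prod_gen_ne_zero (List.nodup_range.erase k) h''

end SkewModel

end Evaluation

/-! ### The free superalgebra on one even and one odd generator -/

section OneOne

variable {F : Type u} [Field F]

theorem LieModel.super_mem : LieModel.super F ∈ superalgebrasOf (malcev F ∪ metabelian F) :=
  mem_superalgebrasOf_iff.2 LieModel.isMetabelianMalcev_envelope

theorem SkewModel.super_mem : SkewModel.super F ∈ superalgebrasOf (malcev F ∪ metabelian F) :=
  mem_superalgebrasOf_iff.2 SkewModel.isMetabelianMalcev_envelope

theorem LieModel.point_mem (k i : ℕ) : LieModel.point F k i ∈ envelope (LieModel.super F) := by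
  unfold LieModel.point
  split_ifs
  · exact tmul_mem_envelope (B := LieModel.super F) (gen_mem_odd 0) LieModel.s_mem
  · exact tmul_mem_envelope (B := LieModel.super F) one_mem_even LieModel.d_mem

theorem SkewModel.point_mem (k i : ℕ) : SkewModel.point F k i ∈ envelope (SkewModel.super F) := by
  unfold SkewModel.point
  split_ifs
  · exact tmul_mem_envelope (B := SkewModel.super F) one_mem_even SkewModel.s_mem
  · exact tmul_mem_envelope (B := SkewModel.super F) (gen_mem_odd i) SkewModel.d_mem

theorem LieModel.lift_point_eq_zero {f : NAPoly F} (hf : SatisfiesSuperidentity f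
    (freeSuperalgebra (malcev F ∪ metabelian F) 1 1)) (k : ℕ) :
    FreeNonUnitalNonAssocAlgebra.lift F (LieModel.point F k) f = 0 := by
  refine lift_eq_zero_of_free hf LieModel.super_mem
    (fun z => match z with | .inl _ => LieModel.d | .inr _ => LieModel.s)
    (by rintro (z | z); exacts [LieModel.d_mem, LieModel.s_mem]) (LieModel.point F k) fun i => ?_
  by_cases hi : i = k
  · exact ⟨.inr 0, gen F 0, gen_mem_odd 0, if_pos hi⟩
  · exact ⟨.inl 0, 1, one_mem_even, if_neg hi⟩

theorem SkewModel.lift_point_eq_zero {f : NAPoly F} (hf : SatisfiesSuperidentity f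
    (freeSuperalgebra (malcev F ∪ metabelian F) 1 1)) (k : ℕ) :
    FreeNonUnitalNonAssocAlgebra.lift F (SkewModel.point F k) f = 0 := by
  refine lift_eq_zero_of_free hf SkewModel.super_mem
    (fun z => match z with | .inl _ => SkewModel.s | .inr _ => SkewModel.d)
    (by rintro (z | z); exacts [SkewModel.s_mem, SkewModel.d_mem]) (SkewModel.point F k) fun i => ?_
  by_cases hi : i = k
  · exact ⟨.inl 0, 1, one_mem_even, if_pos hi⟩
  · exact ⟨.inr 0, gen F i, gen_mem_odd i, if_neg hi⟩

/-- The values of a polynomial in terms of the normal forms of its words. -/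
theorem lift_eq_sum_leftNormed {f : NAPoly F} {c : FreeMagma ℕ → ℤ} {i j : FreeMagma ℕ → ℕ}
    {l : FreeMagma ℕ → List ℕ} {A : Type v} [NonUnitalNonAssocRing A] [Module F A]
    [IsScalarTower F A A] [SMulCommClass F A A]
    (h : ∀ w ∈ f.coeff.support, ∀ a : ℕ → A,
      FreeMagma.lift a w = c w • leftNormed (a (i w) * a (j w)) ((l w).map a)) (a : ℕ → A) :
    FreeNonUnitalNonAssocAlgebra.lift F a f = ∑ w ∈ f.coeff.support,
      (f.coeff w * (c w : F)) • leftNormed (a (i w) * a (j w)) ((l w).map a) := by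
  rw [lift_eq_sum]
  refine Finset.sum_congr rfl fun w hw => ?_
  rw [h w hw, mul_smul, Int.cast_smul_eq_zsmul]

/-- The normal form is available in the envelope, which is a metabelian Malcev algebra, and not in
all of `G ⊗ B`; the computation is made there and then transported to `G ⊗ B`, where the test points
are evaluated. -/
theorem sum_leftNormed_eq_zero {f : NAPoly F} {c : FreeMagma ℕ → ℤ} {i j : FreeMagma ℕ → ℕ}
    {l : FreeMagma ℕ → List ℕ} {B : Superalgebra F}
    (h : ∀ w ∈ f.coeff.support, ∀ a : ℕ → envelope B,
      FreeMagma.lift a w = c w • leftNormed (a (i w) * a (j w)) ((l w).map a))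
    {x : ℕ → Grassmann F ⊗[F] B.carrier} (hx : ∀ k, x k ∈ envelope B)
    (h0 : FreeNonUnitalNonAssocAlgebra.lift F x f = 0) :
    ∑ w ∈ f.coeff.support,
      (f.coeff w * (c w : F)) • leftNormed (x (i w) * x (j w)) ((l w).map x) = 0 := by
  let a : ℕ → envelope B := fun k => ⟨x k, hx k⟩
  have h1 := coe_lift_envelope a f
  rw [lift_eq_sum_leftNormed h a] at h1
  refine Eq.trans ?_ (h1.trans h0)
  refine Eq.trans ?_ (map_sum (NonUnitalSubalgebraClass.subtype (envelope B)) _ _).symm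
  refine Finset.sum_congr rfl fun w _ => ?_
  refine congrArg ((f.coeff w * (c w : F)) • ·) (Eq.trans ?_ (coe_leftNormed _ _).symm)
  rw [List.map_map]
  rfl

/-- The sums in `hP` and `hV` are the coefficients of `p k` and `v k` in the value of `f`. -/
theorem lift_eq_zero_of_sums {f : NAPoly F} {c : FreeMagma ℕ → ℤ} {i j : FreeMagma ℕ → ℕ}
    {l : FreeMagma ℕ → List ℕ} {n : ℕ} {A : Type v} [NonUnitalNonAssocRing A] [Module F A]
    [IsScalarTower F A A] [SMulCommClass F A A]
    (h : ∀ w ∈ f.coeff.support, ∀ a : ℕ → A,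
      FreeMagma.lift a w = c w • leftNormed (a (i w) * a (j w)) ((l w).map a))
    (hperm : ∀ w ∈ f.coeff.support, (i w :: j w :: l w).Perm (List.range n))
    (hP : ∀ k, ∑ w ∈ f.coeff.support, f.coeff w * (c w : F) *
      ((if i w = k then 1 else 0) - (if j w = k then 1 else 0)) = 0)
    (hV : ∀ k, ∑ w ∈ f.coeff.support, f.coeff w * (c w : F) *
      ((listSign (i w :: j w :: l w) : F) *
        ((if i w = k then 1 else 0) + (if j w = k then 1 else 0))) = 0)
    {a p v : ℕ → A} (hpv : ∀ i j l, (i :: j :: l).Perm (List.range n) →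
      leftNormed (a i * a j) (l.map a) = p i - p j + listSign (i :: j :: l) • (v i + v j)) :
    FreeNonUnitalNonAssocAlgebra.lift F a f = 0 := by
  rw [lift_eq_sum_leftNormed h a]
  have hterm : ∀ w ∈ f.coeff.support,
      (f.coeff w * (c w : F)) • leftNormed (a (i w) * a (j w)) ((l w).map a)
        = ∑ k ∈ Finset.range n, ((f.coeff w * (c w : F) *
            ((if i w = k then 1 else 0) - (if j w = k then 1 else 0))) • p k
          + (f.coeff w * (c w : F) * ((listSign (i w :: j w :: l w) : F) *
            ((if i w = k then 1 else 0) + (if j w = k then 1 else 0)))) • v k) := by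
    intro w hw
    have hi : i w ∈ Finset.range n :=
      Finset.mem_range.2 (List.mem_range.1 ((hperm w hw).mem_iff.1 (by simp)))
    have hj : j w ∈ Finset.range n :=
      Finset.mem_range.2 (List.mem_range.1 ((hperm w hw).mem_iff.1 (by simp)))
    have hsel : ∀ (m : ℕ) (y : ℕ → A), m ∈ Finset.range n →
        ∑ k ∈ Finset.range n, (if m = k then (1 : F) else 0) • y k = y m := by
      intro m y hm
      simp only [ite_smul, one_smul, zero_smul]
      rw [Finset.sum_ite_eq, if_pos hm]
    rw [hpv _ _ _ (hperm w hw), Finset.sum_add_distrib]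
    simp only [mul_smul, ← Finset.smul_sum, sub_smul, add_smul, Finset.sum_sub_distrib,
      Finset.sum_add_distrib, hsel _ _ hi, hsel _ _ hj, Int.cast_smul_eq_zsmul, smul_add]
  rw [Finset.sum_congr rfl hterm, Finset.sum_comm]
  refine Finset.sum_eq_zero fun k _ => ?_
  rw [Finset.sum_add_distrib, ← Finset.sum_smul, ← Finset.sum_smul, hP, hV, zero_smul, zero_smul,
    add_zero]

/-- The points of `LieModel` give `hP` and those of `SkewModel` give `hV`: both models are
evaluations of the free superalgebra on one even and one odd generator. These conditions force `f`
to vanish on every envelope in the variety. -/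
theorem superalgebrasOf_subset [CharZero F] :
    superalgebrasOf (malcev F ∪ metabelian F)
      ⊆ superrankVariety (malcev F ∪ metabelian F) 1 1 := by
  rintro B hB f ⟨n, hf⟩ hfree a
  have hlie := LieModel.lift_point_eq_zero hfree
  have hskew := SkewModel.lift_point_eq_zero hfree
  have hleaves : ∀ w ∈ f.coeff.support, (leaves w).Perm (List.range n) := fun w hw =>
    leaves_perm_range (hf w hw)
  by_cases hn : 2 ≤ n
  · choose c i j l h using exists_normalForm.{u}
    have hlen : ∀ w ∈ f.coeff.support, 2 ≤ (leaves w).length := fun w hw => by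
      rw [(hleaves w hw).length_eq, List.length_range]
      exact hn
    have hperm : ∀ w ∈ f.coeff.support, (i w :: j w :: l w).Perm (List.range n) := fun w hw =>
      (h w (hlen w hw)).1.trans (hleaves w hw)
    have hnodup : ∀ w ∈ f.coeff.support, (i w :: j w :: l w).Nodup := fun w hw =>
      (hperm w hw).nodup_iff.2 List.nodup_range
    have hP : ∀ k, ∑ w ∈ f.coeff.support, f.coeff w * (c w : F) *
        ((if i w = k then 1 else 0) - (if j w = k then 1 else 0)) = 0 := by
      intro k
      have h1 := sum_leftNormed_eq_zero (B := LieModel.super F)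
        (fun w hw a => (h w (hlen w hw)).2 _ LieModel.isMetabelianMalcev_envelope a)
        (LieModel.point_mem k) (hlie k)
      have h2 : (∑ w ∈ f.coeff.support, f.coeff w * (c w : F) *
          ((if i w = k then 1 else 0) - (if j w = k then 1 else 0))) •
          (gen F 0 ⊗ₜ[F] (LieModel.s : LieModel F)) = 0 := by
        rw [Finset.sum_smul]
        refine Eq.trans (Finset.sum_congr rfl fun w hw => ?_) h1
        rw [mul_smul]
        exact congrArg _ (LieModel.leftNormed_point (hnodup w hw)).symm
      exact (smul_eq_zero.1 h2).resolve_right LieModel.gen_tmul_s_ne_zero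
    have hV : ∀ k, ∑ w ∈ f.coeff.support, f.coeff w * (c w : F) *
        ((listSign (i w :: j w :: l w) : F) *
          ((if i w = k then 1 else 0) + (if j w = k then 1 else 0))) = 0 := by
      intro k
      have h1 := sum_leftNormed_eq_zero (B := SkewModel.super F)
        (fun w hw a => (h w (hlen w hw)).2 _ SkewModel.isMetabelianMalcev_envelope a)
        (SkewModel.point_mem k) (hskew k)
      have h2 : (∑ w ∈ f.coeff.support, f.coeff w * (c w : F) *
          ((listSign (i w :: j w :: l w) : F) *
            ((if i w = k then 1 else 0) + (if j w = k then 1 else 0)))) •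
          SkewModel.value F n k = 0 := by
        rw [Finset.sum_smul]
        refine Eq.trans (Finset.sum_congr rfl fun w hw => ?_) h1
        rw [mul_smul]
        exact congrArg _ (SkewModel.leftNormed_point (hperm w hw)).symm
      exact (smul_eq_zero.1 h2).resolve_right (SkewModel.value_ne_zero n k)
    have hE := mem_superalgebrasOf_iff.1 hB
    obtain ⟨p, v, hpv⟩ := exists_leftNormed_eq F hE a n
    exact lift_eq_zero_of_sums (fun w hw a => (h w (hlen w hw)).2 _ hE a) hperm hP hV hpv
  -- In degree at most one, `f` is a multiple of `x 0`, and its coefficient is read off at a single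
  -- point of `LieModel`.
  · have hw : ∀ w ∈ f.coeff.support, w = .of 0 := by
      intro w hw
      have hp := hleaves w hw
      have hlen := hp.length_eq
      rw [List.length_range] at hlen
      match w with
      | .of k =>
        have hn1 : n = 1 := hlen.symm
        subst hn1
        have hk : k = 0 := by simpa [leaves] using List.perm_singleton.1 hp
        rw [hk]
      | .mul u w =>
        have h1 := List.length_pos_iff.2 (leaves_ne_nil u)
        have h2 := List.length_pos_iff.2 (leaves_ne_nil w)
        have h3 : (leaves u ++ leaves w).length = n := hlen
        rw [List.length_append] at h3
        omega
    have hsum : ∀ (A : Type u) [NonUnitalNonAssocRing A] [Module F A] [IsScalarTower F A A]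
        [SMulCommClass F A A] (a : ℕ → A), FreeNonUnitalNonAssocAlgebra.lift F a f
          = (∑ w ∈ f.coeff.support, f.coeff w) • a 0 := by
      intro A _ _ _ _ a
      rw [lift_eq_sum, Finset.sum_smul]
      refine Finset.sum_congr rfl fun w hw' => ?_
      rw [hw w hw']
      rfl
    have h0 := hlie 0
    rw [hsum, LieModel.point, if_pos rfl] at h0
    refine (hsum _ a).trans ?_
    rw [(smul_eq_zero.1 h0).resolve_right LieModel.gen_tmul_s_ne_zero]
    exact zero_smul F (a 0)

end OneOne

/-! ### Polynomials symmetric or alternating in all but two variables -/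

section Polarized

theorem polarized_cons_cons {A : Type v} [NonUnitalNonAssocRing A] (δ : ℤ) (w x y : A)
    (l : List A) : polarized δ w (x :: y :: l)
      = leftNormed w (x :: y :: l) + δ • leftNormed w (y :: x :: l) := by
  have hz : ∀ (k : ℤ) (w : A), leftNormed (k • w) l = k • leftNormed w l := fun k w =>
    map_zsmul (⟨⟨fun w => leftNormed w l, leftNormed_zero l⟩,
      fun w w' => leftNormed_add w w' l⟩ : A →+ A) k w
  simp only [polarized, leftNormed_cons]
  rw [leftNormed_add, hz]

theorem polarized_eq_zero_of_perm {A : Type v} [NonUnitalNonAssocRing A]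
    (hA : IsMetabelianMalcev A) {δ : ℤ} (hδ : δ * δ = 1) {l l' : List A} (h : l.Perm l') (p q : A)
    (h0 : polarized δ (p * q) l = 0) : polarized δ (p * q) l' = 0 := by
  induction h generalizing p q with
  | nil => exact h0
  | @cons x l l' h ih =>
    by_cases h2 : 2 ≤ l.length
    · rw [hA.polarized_cons _ _ _ _ (h.length_eq ▸ h2)]
      rw [hA.polarized_cons _ _ _ _ h2] at h0
      exact ih _ _ h0
    · match l, h2, h with
      | [], _, h => rwa [← h.nil_eq]
      | [y], _, h => rwa [← List.singleton_perm.1 h]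
      | _ :: _ :: _, h2, _ => simp at h2
  | swap x y l =>
    rw [polarized_cons_cons] at h0 ⊢
    have := congrArg (δ • ·) h0
    simp only [smul_add, smul_smul, hδ, one_smul, smul_zero] at this
    rw [add_comm]
    exact this
  | trans h1 _ ih1 ih2 => exact ih2 _ _ (ih1 _ _ h0)

theorem map_leftNormed {F : Type u} [Field F] {A : Type*} [NonUnitalNonAssocRing A] [Module F A] {B : Type*} [NonUnitalNonAssocRing B] [Module F B] (φ : A →ₙₐ[F] B) (w : A)
    (l : List A) : φ (leftNormed w l) = leftNormed (φ w) (l.map φ) := by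
  induction l generalizing w with
  | nil => rfl
  | cons x l ih => rw [leftNormed_cons, List.map_cons, leftNormed_cons, ih, map_mul]

theorem leftNormed_smul {F : Type u} [Field F] {A : Type v} [NonUnitalNonAssocRing A] [Module F A]
    [IsScalarTower F A A] (c : F) (w : A) (l : List A) :
    leftNormed (c • w) l = c • leftNormed w l := by
  induction l generalizing w with
  | nil => rfl
  | cons x l ih => rw [leftNormed_cons, leftNormed_cons, smul_mul_assoc, ih]

/-! ### Multilinearity of polarized products -/

section Linear

variable {F : Type u} [Field F] {A : Type v} [NonUnitalNonAssocRing A] [Module F A]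
  [IsScalarTower F A A] [SMulCommClass F A A]

/-- The left-normed product as a linear function of one of the factors. -/
def leftNormedLinear (F : Type u) [Field F] [Module F A] [IsScalarTower F A A]
    [SMulCommClass F A A] (w : A) (l l' : List A) : A →ₗ[F] A where
  toFun y := leftNormed w (l ++ y :: l')
  map_add' y y' := by
    simp only [leftNormed_append, leftNormed_cons, mul_add, leftNormed_add]
  map_smul' c y := by
    simp only [leftNormed_append, leftNormed_cons, mul_smul_comm, leftNormed_smul, RingHom.id_apply]

theorem exists_linearMap_polarized (δ : ℤ) (w : A) (l l' : List A)
    (h : 2 ≤ (l ++ (0 : A) :: l').length) :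
    ∃ φ : A →ₗ[F] A, ∀ y, polarized δ w (l ++ y :: l') = φ y := by
  match l, l', h with
  | [], [], h => simp at h
  | [], x :: l', _ =>
    exact ⟨leftNormedLinear F w [] (x :: l') + δ • leftNormedLinear F w [x] l',
      fun y => polarized_cons_cons δ w y x l'⟩
  | [x], l', _ =>
    exact ⟨leftNormedLinear F w [x] l' + δ • leftNormedLinear F w [] (x :: l'),
      fun y => polarized_cons_cons δ w x y l'⟩
  | x :: x' :: l, l', _ =>
    exact ⟨leftNormedLinear F w (x :: x' :: l) l' + δ • leftNormedLinear F w (x' :: x :: l) l',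
      fun y => polarized_cons_cons δ w x x' (l ++ y :: l')⟩

theorem polarized_eq_zero_of_span {δ : ℤ} {w : A} {Y : Set A} {m : ℕ} (hm : 2 ≤ m)
    (h : ∀ l : List A, l.length = m → (∀ y ∈ l, y ∈ Y) → polarized δ w l = 0) (l : List A)
    (hl : l.length = m) (hlY : ∀ y ∈ l, y ∈ Submodule.span F Y) : polarized δ w l = 0 := by
  -- The factors are reduced from the span to `Y` one at a time: `l₁` is the part already in `Y`.
  suffices H : ∀ l₂ l₁ : List A, (l₁ ++ l₂).length = m → (∀ y ∈ l₁, y ∈ Y) →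
      (∀ y ∈ l₂, y ∈ Submodule.span F Y) → polarized δ w (l₁ ++ l₂) = 0 from
    H l [] hl (fun y hy => absurd hy List.not_mem_nil) hlY
  intro l₂
  induction l₂ with
  | nil =>
    intro l₁ hlen h₁ _
    rw [List.append_nil] at hlen ⊢
    exact h l₁ hlen h₁
  | cons y l₂ ih =>
    intro l₁ hlen h₁ h₂
    obtain ⟨φ, hφ⟩ := exists_linearMap_polarized (F := F) δ w l₁ l₂ (by
      rw [List.length_append, List.length_cons] at hlen ⊢
      omega)
    rw [hφ]
    have hle : Submodule.span F Y ≤ LinearMap.ker φ := by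
      refine Submodule.span_le.2 fun y hy => ?_
      change φ y = 0
      rw [← hφ, List.append_cons]
      refine ih (l₁ ++ [y]) ?_ ?_ fun z hz => h₂ z (List.mem_cons_of_mem _ hz)
      · rw [← hlen]
        simp
      · intro z hz
        rcases List.mem_append.1 hz with hz | hz
        · exact h₁ z hz
        · rwa [List.mem_singleton.1 hz]
    exact hle (h₂ y List.mem_cons_self)

end Linear
theorem leftNormed_eq_zero_of_mem {A : Type v} [NonUnitalNonAssocRing A] {y : A}
    (hy : ∀ s t : A, s * t * y = 0) {l : List A} (hl : y ∈ l) (p q : A) :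
    leftNormed (p * q) l = 0 := by
  induction l generalizing p q with
  | nil => exact absurd hl List.not_mem_nil
  | cons x l ih =>
    rw [leftNormed_cons]
    rcases List.mem_cons.1 hl with rfl | hl
    · rw [hy, leftNormed_zero]
    · exact ih hl _ _

theorem polarized_eq_zero_of_mem {A : Type v} [NonUnitalNonAssocRing A] {y : A}
    (hy : ∀ s t : A, s * t * y = 0) {l : List A} (hl : y ∈ l) (hlen : 2 ≤ l.length) (δ : ℤ)
    (p q : A) : polarized δ (p * q) l = 0 := by
  match l, hlen with
  | x :: x' :: l, _ =>
    rw [polarized_cons_cons, leftNormed_eq_zero_of_mem hy hl,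
      leftNormed_eq_zero_of_mem hy ((List.Perm.swap x' x l).mem_iff.1 hl), smul_zero, add_zero]

theorem map_polarized {F : Type u} [Field F] {A B : Type*} [NonUnitalNonAssocRing A]
    [NonUnitalNonAssocRing B] [Module F A] [Module F B] (φ : A →ₙₐ[F] B) (δ : ℤ) (w x y : A)
    (l : List A) : φ (polarized δ w (x :: y :: l)) = polarized δ (φ w) ((x :: y :: l).map φ) := by
  rw [polarized_cons_cons, map_add, map_zsmul, map_leftNormed, map_leftNormed]
  simp only [List.map_cons]
  rw [polarized_cons_cons]

theorem coe_polarized {F : Type u} [Field F] {B : Superalgebra F} (δ : ℤ) (w : envelope B)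
    (l : List (envelope B)) (hl : 2 ≤ l.length) :
    ((polarized δ w l : envelope B) : Grassmann F ⊗[F] B.carrier)
      = polarized δ w.1 (l.map Subtype.val) := by
  match l, hl with
  | x :: y :: l, _ =>
    rw [polarized_cons_cons, List.map_cons, List.map_cons, polarized_cons_cons]
    refine congrArg₂ (· + ·) (coe_leftNormed _ _) ?_
    exact congrArg (δ • ·) (coe_leftNormed w (y :: x :: l))

theorem exists_perm_of_not_nodup_map {A B : Type*} (ζ : A → B) {l : List A}
    (h : ¬(l.map ζ).Nodup) : ∃ x y l', l.Perm (x :: y :: l') ∧ ζ x = ζ y := by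
  induction l with
  | nil => exact absurd List.nodup_nil h
  | cons x l ih =>
    by_cases hx : ζ x ∈ l.map ζ
    · obtain ⟨y, hy, hyx⟩ := List.mem_map.1 hx
      obtain ⟨l₁, l₂, rfl⟩ := List.append_of_mem hy
      exact ⟨x, y, l₁ ++ l₂, List.perm_middle.cons x, hyx.symm⟩
    · obtain ⟨y, z, l', hp, he⟩ := ih fun hn => h (List.nodup_cons.2 ⟨hx, hn⟩)
      exact ⟨y, z, x :: l', (hp.cons x).trans
        ((List.Perm.swap y x _).trans ((List.Perm.swap z x _).cons y)), he⟩

end Polarized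

/-! ### The polynomials on the free superalgebra -/

section FreeVanishing

variable {F : Type u} [Field F]

theorem tmul_ne_zero_imp {M : Type v} [AddCommGroup M] [Module F M] {g : Grassmann F} (hg : g ≠ 0)
    {m : M} (h : g ⊗ₜ[F] m = 0) : m = 0 := by
  obtain ⟨ψ, hψ⟩ : ∃ ψ : Module.Dual F (Grassmann F), ψ g ≠ 0 := by
    by_contra hc
    push Not at hc
    exact hg ((Module.forall_dual_apply_eq_zero_iff F g).1 hc)
  have := congrArg (slice ψ) h
  rw [slice_tmul, map_zero] at this
  exact (smul_eq_zero.1 this).resolve_left hψ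

/-- The square of a metabelian superalgebra has zero multiplication. -/
theorem mul_mul_mul_eq_zero {B : Superalgebra F} (hB : IsMetabelianMalcev (envelope B))
    (a b c d : B.carrier) : a * b * (c * d) = 0 := by
  -- Even elements get the coefficient `1` and odd ones get distinct generators, so the product of
  -- the four coefficients is nonzero and can be cancelled.
  let γ : ZMod 2 → ℕ → List ℕ := fun i n => if i = 0 then [] else [n]
  have hγ : ∀ i n, ((γ i n).map (gen F)).prod ∈ grassmannPart F i := by
    intro i n
    rcases zmod_two_cases i with rfl | rfl
    · simpa [γ] using one_mem_even (F := F)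
    · simpa [γ] using gen_mem_odd (F := F) n
  have h₀ : ∀ (a b c d : B.carrier) (i j k l), a ∈ B.part i → b ∈ B.part j → c ∈ B.part k →
      d ∈ B.part l → a * b * (c * d) = 0 := by
    intro a b c d i j k l ha hb hc hd
    have h := congrArg Subtype.val (hB.metabelian ⟨_, tmul_mem_envelope (hγ i 0) ha⟩
      ⟨_, tmul_mem_envelope (hγ j 1) hb⟩ ⟨_, tmul_mem_envelope (hγ k 2) hc⟩
      ⟨_, tmul_mem_envelope (hγ l 3) hd⟩)
    change (_ ⊗ₜ[F] a * _ ⊗ₜ[F] b) * (_ ⊗ₜ[F] c * _ ⊗ₜ[F] d) = 0 at h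
    simp only [Algebra.TensorProduct.tmul_mul_tmul, ← List.prod_append, ← List.map_append] at h
    refine tmul_ne_zero_imp (prod_gen_ne_zero ?_) h
    rcases zmod_two_cases i with rfl | rfl <;> rcases zmod_two_cases j with rfl | rfl <;>
      rcases zmod_two_cases k with rfl | rfl <;> rcases zmod_two_cases l with rfl | rfl <;> decide
  have hsplit : ∀ x : B.carrier, ∃ y ∈ B.part 0, ∃ z ∈ B.part 1, y + z = x := fun x =>
    Submodule.mem_sup.1 (B.isCompl.sup_eq_top ▸ Submodule.mem_top)
  have h₁ : ∀ (a b c d : B.carrier) (j k l), b ∈ B.part j → c ∈ B.part k → d ∈ B.part l →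
      a * b * (c * d) = 0 := by
    intro a b c d j k l hb hc hd
    obtain ⟨y, hy, z, hz, rfl⟩ := hsplit a
    rw [add_mul, add_mul, h₀ _ _ _ _ _ _ _ _ hy hb hc hd, h₀ _ _ _ _ _ _ _ _ hz hb hc hd, add_zero]
  have h₂ : ∀ (a b c d : B.carrier) (k l), c ∈ B.part k → d ∈ B.part l →
      a * b * (c * d) = 0 := by
    intro a b c d k l hc hd
    obtain ⟨y, hy, z, hz, rfl⟩ := hsplit b
    rw [mul_add, add_mul, h₁ _ _ _ _ _ _ _ hy hc hd, h₁ _ _ _ _ _ _ _ hz hc hd, add_zero]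
  have h₃ : ∀ (a b c d : B.carrier) (l), d ∈ B.part l → a * b * (c * d) = 0 := by
    intro a b c d l hd
    obtain ⟨y, hy, z, hz, rfl⟩ := hsplit c
    rw [add_mul, mul_add, h₂ _ _ _ _ _ _ hy hd, h₂ _ _ _ _ _ _ hz hd, add_zero]
  obtain ⟨y, hy, z, hz, rfl⟩ := hsplit d
  rw [mul_add, mul_add, h₃ _ _ _ _ _ hy, h₃ _ _ _ _ _ hz, add_zero]

/-- The class of a word in the free superalgebra. -/
def freeWord (S : Set (NAPoly F)) {r s : ℕ} (w : FreeMagma (Fin r ⊕ Fin s)) :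
    (freeSuperalgebra S r s).carrier := freeMk S r s (MonoidAlgebra.ofMagma F _ w)

theorem freeWord_mul (S : Set (NAPoly F)) {r s : ℕ} (u v : FreeMagma (Fin r ⊕ Fin s)) :
    freeWord S (u * v) = freeWord S u * freeWord S v :=
  congrArg (freeMk S r s) (map_mul (MonoidAlgebra.ofMagma F _) u v)

theorem freeWord_mem (S : Set (NAPoly F)) {r s : ℕ} (w : FreeMagma (Fin r ⊕ Fin s)) :
    freeWord S w ∈ (freeSuperalgebra S r s).part (wordParity w) :=
  ⟨_, Submodule.subset_span ⟨w, rfl, rfl⟩, rfl⟩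

/-- The multiples of the classes of words that lie in the envelope of the free superalgebra. -/
def envelopeWords (S : Set (NAPoly F)) (r s : ℕ) :
    Set (Grassmann F ⊗[F] (freeSuperalgebra S r s).carrier) :=
  {t | ∃ w : FreeMagma (Fin r ⊕ Fin s), ∃ g ∈ grassmannPart F (wordParity w),
    t = g ⊗ₜ freeWord S w}

/-- The classes of the words times homogeneous elements of the Grassmann algebra span the
envelope of the free superalgebra. -/
theorem envelope_free_le (S : Set (NAPoly F)) (r s : ℕ) :
    envelopeSubmodule (freeSuperalgebra S r s) ≤ Submodule.span F (envelopeWords S r s) := by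
  unfold envelopeSubmodule
  refine Submodule.span_le.2 ?_
  rintro _ ⟨i, g, hg, _, ⟨x, hx, rfl⟩, rfl⟩
  let φ : FreeNA F r s →ₗ[F] Grassmann F ⊗[F] (freeSuperalgebra S r s).carrier :=
    (TensorProduct.mk F (Grassmann F) (freeSuperalgebra S r s).carrier g) ∘ₗ freeMk S r s
  have hle : freePart F r s i ≤ (Submodule.span F (envelopeWords S r s)).comap φ := by
    unfold freePart
    refine Submodule.span_le.2 ?_
    rintro _ ⟨w, rfl, rfl⟩
    exact Submodule.subset_span ⟨w, g, hg, rfl⟩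
  exact hle hx

/-- When both factors carry the same element `e`, exchanging them only exchanges their Grassmann
coefficients; `δ` is opposite to the sign with which these commute. -/
theorem polarized_swap_eq_zero {A : Type v} [NonUnitalNonAssocRing A] [Module F A]
    [IsScalarTower F A A] [SMulCommClass F A A] {δ : ℤ} {g h : Grassmann F}
    (hgh : g * h + δ • (h * g) = 0) (e : A) (w : Grassmann F ⊗[F] A) :
    w * (g ⊗ₜ e) * (h ⊗ₜ e) + δ • (w * (h ⊗ₜ e) * (g ⊗ₜ e)) = 0 := by
  induction w with
  | zero => simp
  | add x y hx hy =>
    simp only [add_mul, smul_add]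
    rw [add_add_add_comm, hx, hy, add_zero]
  | tmul k b =>
    simp only [Algebra.TensorProduct.tmul_mul_tmul]
    rw [← Int.cast_smul_eq_zsmul F, TensorProduct.smul_tmul', ← TensorProduct.add_tmul,
      Int.cast_smul_eq_zsmul, mul_assoc, mul_assoc, ← mul_smul_comm, ← mul_add, hgh, mul_zero,
      TensorProduct.zero_tmul]

/-- In the envelope of the free superalgebra on fewer than `m` generators of one parity, the
polarized products with `m` factors vanish. -/
theorem polarized_envelope_free_eq_zero {S : Set (NAPoly F)} {r s m : ℕ}
    (hS : IsMetabelianMalcev (envelope (freeSuperalgebra S r s))) {δ : ℤ} (hδ : δ * δ = 1)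
    (q : ZMod 2) (hq : ∀ z : Fin r ⊕ Fin s, genParity z = q)
    (hcomm : ∀ g ∈ grassmannPart F q, ∀ h ∈ grassmannPart F q, g * h + δ • (h * g) = 0)
    (hm : 2 ≤ m) (hrs : r + s < m) (x y : envelope (freeSuperalgebra S r s))
    (l : List (envelope (freeSuperalgebra S r s))) (hl : l.length = m) :
    polarized δ (x * y) l = 0 := by
  refine Subtype.ext ((coe_polarized δ (x * y) l (hl ▸ hm)).trans ?_)
  refine polarized_eq_zero_of_span (F := F) hm ?_ (l.map Subtype.val) (by rw [List.length_map, hl])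
    (Y := envelopeWords S r s) ?_
  · intro l hl hlY
    -- A factor that is a decomposable word annihilates products, so only factors that are multiples
    -- of generators remain.
    by_cases hprod : ∃ t ∈ l, ∃ u v : FreeMagma (Fin r ⊕ Fin s), ∃ g : Grassmann F,
        t = g ⊗ₜ freeWord S (u * v)
    · obtain ⟨t, ht, u, v, g, rfl⟩ := hprod
      refine polarized_eq_zero_of_mem (fun a b => ?_) ht (hl ▸ hm) δ x.1 y.1
      induction a with
      | zero => rw [zero_mul, zero_mul]
      | add a a' h h' => rw [add_mul, add_mul, h, h', add_zero]
      | tmul g₁ a =>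
        induction b with
        | zero => rw [mul_zero, zero_mul]
        | add b b' h h' => rw [mul_add, add_mul, h, h', add_zero]
        | tmul g₂ b =>
          rw [Algebra.TensorProduct.tmul_mul_tmul, Algebra.TensorProduct.tmul_mul_tmul,
            freeWord_mul, mul_mul_mul_eq_zero hS, TensorProduct.tmul_zero]
    · have hgen : ∀ t ∈ l, ∃ z : Fin r ⊕ Fin s, ∃ g ∈ grassmannPart F q, t = g ⊗ₜ freeWord S (.of z) := by
        intro t ht
        obtain ⟨w, g, hg, rfl⟩ := hlY t ht
        match w with
        | .of z => exact ⟨z, g, hq z ▸ hg, rfl⟩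
        | .mul u v => exact absurd ⟨_, ht, u, v, g, rfl⟩ hprod
      have hne : Nonempty (Fin r ⊕ Fin s) := by
        obtain ⟨t, ht⟩ := List.exists_mem_of_length_pos (l := l) (by omega)
        exact ⟨(hgen t ht).choose⟩
      choose! ζ g hg hζ using hgen
      -- There are more factors than generators, so two factors belong to the same generator; a
      -- permutation brings them to the front.
      have hnodup : ¬(l.map ζ).Nodup := by
        intro hn
        have := hn.length_le_card
        rw [List.length_map, hl, Fintype.card_sum, Fintype.card_fin, Fintype.card_fin] at this
        omega
      obtain ⟨a, b, l', hperm, hab⟩ := exists_perm_of_not_nodup_map ζ hnodup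
      have hmem : ∀ t ∈ a :: b :: l', t ∈ envelope (freeSuperalgebra S r s) := by
        intro t ht
        have ht := hperm.mem_iff.2 ht
        rw [hζ t ht]
        exact tmul_mem_envelope (hg t ht) (hq (ζ t) ▸ freeWord_mem S (.of (ζ t)))
      have h0 : polarized δ (x.1 * y.1) (a :: b :: l') = 0 := by
        have ha := hperm.mem_iff.2 (List.mem_cons_self (a := a) (l := b :: l'))
        have hb := hperm.mem_iff.2 (List.mem_cons_of_mem a (List.mem_cons_self (a := b) (l := l')))
        rw [polarized, hζ a ha, hζ b hb, ← hab]
        rw [polarized_swap_eq_zero (hcomm _ (hg a ha) _ (hg b hb)), leftNormed_zero]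
      -- Permuting the factors uses the Malcev identities, so the lists are pulled back to the
      -- envelope.
      have hpull : ∀ l : List (Grassmann F ⊗[F] (freeSuperalgebra S r s).carrier),
          (∀ t ∈ l, t ∈ envelope (freeSuperalgebra S r s)) →
          ∃ l' : List (envelope (freeSuperalgebra S r s)), l'.map Subtype.val = l := fun l h =>
        ⟨l.pmap Subtype.mk h, by simp [List.map_pmap]⟩
      obtain ⟨k, rfl⟩ := hpull l fun t ht => hmem t (hperm.mem_iff.1 ht)
      obtain ⟨k', hk'⟩ := hpull _ hmem
      rw [← hk'] at h0 hperm
      have hkk' : k.Perm k' := (List.map_perm_map_iff Subtype.val_injective).1 hperm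
      have hk : 2 ≤ k.length := by
        rw [List.length_map] at hl
        omega
      have h0' : polarized δ (x * y) k' = 0 :=
        Subtype.ext ((coe_polarized δ (x * y) k' (hkk'.length_eq ▸ hk)).trans h0)
      have h1 := polarized_eq_zero_of_perm hS hδ hkk'.symm x y h0'
      exact (coe_polarized δ (x * y) k hk).symm.trans (congrArg Subtype.val h1)
  · intro t ht
    obtain ⟨t, -, rfl⟩ := List.mem_map.1 ht
    exact envelope_free_le S r s t.2

end FreeVanishing

/-! ### Superidentities of free superalgebras on generators of one parity -/

section Separation

variable {F : Type u} [Field F]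

/-- The polynomial symmetrized (`δ = 1`) or alternated (`δ = -1`) in the variables
`x 2, …, x (m + 3)`, modulo the identities of metabelian Malcev algebras. -/
def polarizedPoly (F : Type u) [Field F] (δ : ℤ) (m : ℕ) : NAPoly F :=
  polarized δ (var F 0 * var F 1) ((2 :: 3 :: List.range' 4 m).map (var F))

theorem range_perm_polarized (m : ℕ) :
    (0 :: 1 :: 2 :: 3 :: List.range' 4 m).Perm (List.range (m + 4)) := by
  rw [List.range_eq_range']
  exact List.Perm.refl _

theorem isMultilinearOfDegree_leftNormed {n : ℕ} {i j : ℕ} {l : List ℕ}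
    (h : (i :: j :: l).Perm (List.range n)) :
    IsMultilinearOfDegree n (leftNormed (var F i * var F j) (l.map (var F))) := by
  have key : ∀ (l : List ℕ) (w : FreeMagma ℕ), ∃ w', leaves w' = leaves w ++ l ∧
      wordPoly F w' = leftNormed (wordPoly F w) (l.map (var F)) := by
    intro l
    induction l with
    | nil => exact fun w => ⟨w, (List.append_nil _).symm, rfl⟩
    | cons k l ih =>
      intro w
      obtain ⟨w', h1, h2⟩ := ih (w * .of k)
      refine ⟨w', h1.trans ?_, h2.trans ?_⟩
      · change (leaves w ++ [k]) ++ l = _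
        rw [List.append_assoc]
        rfl
      · rw [wordPoly_mul, wordPoly_of, List.map_cons, leftNormed_cons]
  obtain ⟨w, h1, h2⟩ := key l (.of i * .of j)
  rw [← wordPoly_of, ← wordPoly_of, ← wordPoly_mul, ← h2]
  refine isMultilinearOfDegree_wordPoly fun k => ?_
  have h3 : (leaves w).Perm (List.range n) := h1 ▸ h
  rw [occ_eq_count, h3.count_eq, List.nodup_range.count]
  simp

theorem isMultilinear_polarizedPoly {δ : ℤ} (hδ : δ = 1 ∨ δ = -1) (m : ℕ) :
    IsMultilinear (polarizedPoly F δ m) := by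
  refine ⟨m + 4, ?_⟩
  change IsMultilinearOfDegree (m + 4) _
  have h1 := isMultilinearOfDegree_leftNormed (F := F) (range_perm_polarized m)
  have h2 := isMultilinearOfDegree_leftNormed (F := F)
    ((((List.Perm.swap 2 3 (List.range' 4 m)).cons 1).cons 0).trans (range_perm_polarized m))
  simp only [polarizedPoly, List.map_cons] at h1 h2 ⊢
  rw [polarized_cons_cons]
  rcases hδ with rfl | rfl
  · rw [one_smul]
    exact h1.add h2
  · rw [neg_one_smul, ← sub_eq_add_neg]
    exact h1.sub h2

theorem lift_polarizedPoly {A : Type v} [NonUnitalNonAssocRing A] [Module F A] [IsScalarTower F A A]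
    [SMulCommClass F A A] (a : ℕ → A) (δ : ℤ) (m : ℕ) :
    FreeNonUnitalNonAssocAlgebra.lift F a (polarizedPoly F δ m)
      = polarized δ (a 0 * a 1) ((2 :: 3 :: List.range' 4 m).map a) := by
  simp only [polarizedPoly, List.map_cons]
  rw [map_polarized, map_mul, lift_var, lift_var]
  simp only [List.map_cons, List.map_map, lift_var]
  congr 3
  refine List.map_congr_left fun k _ => ?_
  exact lift_var a k

theorem satisfiesSuperidentity_polarizedPoly {S : Set (NAPoly F)} {r s m : ℕ}
    (hS : IsMetabelianMalcev (envelope (freeSuperalgebra S r s))) {δ : ℤ} (hδ : δ * δ = 1)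
    (q : ZMod 2) (hq : ∀ z : Fin r ⊕ Fin s, genParity z = q)
    (hcomm : ∀ g ∈ grassmannPart F q, ∀ h ∈ grassmannPart F q, g * h + δ • (h * g) = 0)
    (hm : r + s < m + 2) :
    SatisfiesSuperidentity (polarizedPoly F δ m) (freeSuperalgebra S r s) := by
  intro a
  refine (lift_polarizedPoly a δ m).trans ?_
  exact polarized_envelope_free_eq_zero hS hδ q hq hcomm (by omega) hm (a 0) (a 1) _ (by simp)

theorem LieModel.not_satisfiesSuperidentity [CharZero F] (m : ℕ) :
    ¬SatisfiesSuperidentity (polarizedPoly F 1 m) (LieModel.super F) := by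
  intro h
  have h0 := congrArg Subtype.val (h fun k => ⟨LieModel.point F 0 k, LieModel.point_mem 0 k⟩)
  rw [coe_lift_envelope] at h0
  have h1 := (lift_polarizedPoly (F := F) (LieModel.point F 0) 1 m).symm.trans h0
  have hnodup : (0 :: 1 :: 2 :: 3 :: List.range' 4 m).Nodup :=
    (range_perm_polarized m).nodup_iff.2 List.nodup_range
  have e1 := LieModel.leftNormed_point (F := F) (k := 0) hnodup
  have e2 := LieModel.leftNormed_point (F := F) (k := 0)
    ((((List.Perm.swap 2 3 (List.range' 4 m)).cons 1).cons 0).nodup_iff.2 hnodup)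
  rw [if_pos rfl, if_neg one_ne_zero, sub_zero] at e1 e2
  simp only [List.map_cons] at e1 e2 h1
  rw [polarized_cons_cons, e1, e2, ← Int.cast_smul_eq_zsmul F, smul_smul, ← add_smul] at h1
  have h2 : ((1 : F) + ((1 : ℤ) : F) * 1) = 2 := by norm_num
  rw [h2] at h1
  exact (smul_ne_zero two_ne_zero LieModel.gen_tmul_s_ne_zero) h1

theorem SkewModel.not_satisfiesSuperidentity [CharZero F] (m : ℕ) :
    ¬SatisfiesSuperidentity (polarizedPoly F (-1) m) (SkewModel.super F) := by
  intro h
  have h0 := congrArg Subtype.val (h fun k => ⟨SkewModel.point F 0 k, SkewModel.point_mem 0 k⟩)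
  rw [coe_lift_envelope] at h0
  have h1 := (lift_polarizedPoly (F := F) (SkewModel.point F 0) (-1) m).symm.trans h0
  have e1 := SkewModel.leftNormed_point (F := F) (k := 0) (range_perm_polarized m)
  have e2 := SkewModel.leftNormed_point (F := F) (k := 0)
    ((((List.Perm.swap 2 3 (List.range' 4 m)).cons 1).cons 0).trans (range_perm_polarized m))
  have hsign : listSign (0 :: 1 :: 3 :: 2 :: List.range' 4 m)
      = -listSign (0 :: 1 :: 2 :: 3 :: List.range' 4 m) := by
    simp only [listSign, List.map_cons, List.prod_cons, pairSign_swap (i := 2) (j := 3) (by decide)]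
    ring
  rw [if_pos rfl, if_neg one_ne_zero, add_zero, mul_one] at e1 e2
  rw [hsign] at e2
  simp only [List.map_cons] at e1 e2 h1
  rw [polarized_cons_cons, e1, e2, ← Int.cast_smul_eq_zsmul F, smul_smul, ← add_smul] at h1
  have h2 := (smul_eq_zero.1 h1).resolve_right (SkewModel.value_ne_zero (m + 4) 0)
  -- The two terms of the alternated product add up to twice the sign, which is nonzero because its
  -- square is `1`.
  have h3 := congrArg (Int.cast : ℤ → F) (listSign_mul_self (0 :: 1 :: 2 :: 3 :: List.range' 4 m))
  push_cast at h2 h3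
  have h4 : (listSign (0 :: 1 :: 2 :: 3 :: List.range' 4 m) : F) = 0 := by
    have : (2 : F) * (listSign (0 :: 1 :: 2 :: 3 :: List.range' 4 m) : F) = 0 := by
      rw [← h2]
      ring
    exact (mul_eq_zero.1 this).resolve_left two_ne_zero
  rw [h4, mul_zero] at h3
  exact zero_ne_one h3

/-- The polynomial alternates in `r + 2` variables, more than the number of generators, and even
coefficients commute; hence `δ = -1` and the test superalgebra `SkewModel`. -/
theorem superrankVariety_even_ne [CharZero F] (r : ℕ) :
    superrankVariety (malcev F ∪ metabelian F) r 0 ≠ superalgebrasOf (malcev F ∪ metabelian F) := by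
  intro h
  have hmem : SkewModel.super F ∈ superrankVariety (malcev F ∪ metabelian F) r 0 :=
    h ▸ SkewModel.super_mem
  refine SkewModel.not_satisfiesSuperidentity r
    (hmem _ (isMultilinear_polarizedPoly (Or.inr rfl) r) ?_)
  refine satisfiesSuperidentity_polarizedPoly
    (mem_superalgebrasOf_iff.1 (freeSuperalgebra_mem _ r 0)) (by norm_num) 0 ?_ ?_ (by omega)
  · rintro (z | z)
    · rfl
    · exact z.elim0
  · intro g hg g' _
    rw [neg_one_smul, even_central hg, add_neg_cancel]

/-- Odd coefficients anticommute, so here the polynomial symmetric in `s + 2` variables vanishes,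
and `LieModel` is the test superalgebra. -/
theorem superrankVariety_odd_ne [CharZero F] (s : ℕ) :
    superrankVariety (malcev F ∪ metabelian F) 0 s ≠ superalgebrasOf (malcev F ∪ metabelian F) := by
  intro h
  have hmem : LieModel.super F ∈ superrankVariety (malcev F ∪ metabelian F) 0 s :=
    h ▸ LieModel.super_mem
  refine LieModel.not_satisfiesSuperidentity s
    (hmem _ (isMultilinear_polarizedPoly (Or.inl rfl) s) ?_)
  refine satisfiesSuperidentity_polarizedPoly
    (mem_superalgebrasOf_iff.1 (freeSuperalgebra_mem _ 0 s)) (by norm_num) 1 ?_ ?_ (by omega)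
  · rintro (z | z)
    · exact z.elim0
    · rfl
  · intro g hg g' hg'
    rw [one_smul, odd_anticommute hg hg', neg_add_cancel]

end Separation

end Superrank

end

/-! ### The basic spectrum -/

theorem mainTheorem6 (F : Type u) [Field F] [CharZero F] :
    Superrank.basicSpectrum (Superrank.malcev F ∪ Superrank.metabelian F) = {((1 : ℕ), (1 : ℕ))} := by
  have h11 : Superrank.superrankVariety (Superrank.malcev F ∪ Superrank.metabelian F) 1 1
      = Superrank.superalgebrasOf (Superrank.malcev F ∪ Superrank.metabelian F) :=
    Set.Subset.antisymm (Superrank.superrankVariety_subset 1 1) Superrank.superalgebrasOf_subset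
  -- The pair `(1, 1)` is the least, not merely a minimal, pair generating the whole class, hence
  -- the only minimal one.
  have hle : ∀ q : ℕ × ℕ,
      Superrank.superrankVariety (Superrank.malcev F ∪ Superrank.metabelian F) q.1 q.2
        = Superrank.superalgebrasOf (Superrank.malcev F ∪ Superrank.metabelian F) →
      ((1 : ℕ), (1 : ℕ)) ≤ q := by
    rintro ⟨r, s⟩ h
    refine Prod.mk_le_mk.2 ⟨Nat.one_le_iff_ne_zero.2 ?_, Nat.one_le_iff_ne_zero.2 ?_⟩
    · rintro rfl
      exact Superrank.superrankVariety_odd_ne s h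
    · rintro rfl
      exact Superrank.superrankVariety_even_ne r h
  ext p
  rw [Set.mem_singleton_iff]
  constructor
  · intro hp
    exact le_antisymm (hp.2 h11 (hle p hp.1)) (hle p hp.1)
  · rintro rfl
    exact ⟨h11, fun q hq _ => hle q hq⟩
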